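/- Let $n\ge 1$, let $\mathbb{B}^n$ be the open Euclidean unit ball of $\mathbb{C}^n$, and let $\phi:\mathbb{B}^n\to\mathbb{B}^n$ be analytic with $\phi(0)=0$, with $\phi'(0)$ of full rank (that is, the $n\times n$ matrix $\phi'(0)$ is invertible), and such that $\phi$ is not unitary on any slice, i.e. there are no unit vectors $\zeta,\eta\in\mathbb{C}^n$ with $\phi(t\zeta)=t\eta$ for all $t\in\mathbb{C}$ with $|t|<1$. Write $C_\phi F=F\circ\phi$. Then for every positive integer $k$ there is an analytic map $F=(f_1,\dots,f_n)^t:\mathbb{B}^n\to\mathbb{C}^n$ whose component functions $f_1,\dots,f_n$ are linearly independent over $\mathbb{C}$ and which satisfies $$C_\phi F=\phi'(0)^k F\quad\text{on }\mathbb{B}^n .$$ Furthermore, if $k>1$, then every such $F$ has singular derivative $F'(0)$; in particular no such $F$ has full rank near $0$ (that is, there is no neighbourhood of $0$ on which $F'(z)$ has rank $n$ at every point). -/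

import Mathlib

open Metric Topology

/-- `ℂⁿ` with its Euclidean norm. -/
abbrev Cn (n : ℕ) : Type := EuclideanSpace ℂ (Fin n)

/-- The open Euclidean unit ball `𝔹ⁿ` of `ℂⁿ`. -/
abbrev unitBall (n : ℕ) : Set (Cn n) := ball (0 : Cn n) 1

/-- `φ` restricts to an analytic (holomorphic) map of the unit ball into itself.
Values of `φ` outside the ball play no role. -/
structure IsAnalyticSelfMap {n : ℕ} (φ : Cn n → Cn n) : Prop where
  analytic : AnalyticOnNhd ℂ φ (unitBall n)
  mapsTo : Set.MapsTo φ (unitBall n) (unitBall n)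

/-- `φ` is unitary on some slice: there are unit vectors `ζ`, `η` such that
`φ (t ζ) = t η` for every `t` in the open unit disk. -/
def IsUnitaryOnSomeSlice {n : ℕ} (φ : Cn n → Cn n) : Prop :=
  ∃ ζ η : Cn n, ‖ζ‖ = 1 ∧ ‖η‖ = 1 ∧ ∀ t : ℂ, ‖t‖ < 1 → φ (t • ζ) = t • η

/-- The composition operator `C_φ F = F ∘ φ`. -/
def compositionOperator {n : ℕ} (φ F : Cn n → Cn n) : Cn n → Cn n := F ∘ φ

/-- The component functions `f₁, …, fₙ` of `F = (f₁, …, fₙ)ᵗ`, as functions on the unit ball,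
are linearly independent over `ℂ`. -/
def HasLinearlyIndependentComponents {n : ℕ} (F : Cn n → Cn n) : Prop :=
  LinearIndependent ℂ (fun (i : Fin n) (z : unitBall n) => F z i)

/-- The complex derivative of `F` at `z` has rank `n`. -/
def HasFullRankAt {n : ℕ} (F : Cn n → Cn n) (z : Cn n) : Prop :=
  (fderiv ℂ F z : Cn n →ₗ[ℂ] Cn n).rank = n

/-- `F` has full rank near `0`: its derivative has rank `n` at every point of some
neighbourhood of `0`. -/
def HasFullRankNearZero {n : ℕ} (F : Cn n → Cn n) : Prop :=
  ∀ᶠ z in 𝓝 (0 : Cn n), HasFullRankAt F z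

/-- `F : 𝔹ⁿ → ℂⁿ` is analytic, has linearly independent component functions and satisfies
`C_φ F = φ'(0)ᵏ F` on the ball. The power is taken in the ring of linear
endomorphisms of `ℂⁿ`. -/
structure IsIndependentSolution {n : ℕ} (φ : Cn n → Cn n) (k : ℕ) (F : Cn n → Cn n) : Prop where
  analytic : AnalyticOnNhd ℂ F (unitBall n)
  independent : HasLinearlyIndependentComponents F
  equation : ∀ z ∈ unitBall n, compositionOperator φ F z = ((fderiv ℂ φ 0) ^ k) (F z)

/-! Write `A` for `φ'(0)`, `S` for its transpose and `k = d + 1`. Equality in the Schwarz lemma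
along a slice would make `φ` unitary there, so `‖φ z‖ < ‖z‖` off `0` and `‖A‖ < 1`. Hence the
iterates of `φ` decay like `qʲ`, uniformly on smaller balls, for each `q` strictly between `‖A‖` and
`1` (`exists_norm_iterate_le`).

This reduces existence to a problem on jets. If `R = F₀ ∘ φ - Aᵏ F₀` is `O(‖z‖ᴺ)` and `‖A⁻ᵏ‖ qᴺ <
1`, then `F₀ + ∑ⱼ A^(-k(j+1)) R ∘ φʲ` converges to an exact solution with the same jet below order
`N` (`exists_solution_of_approximate_solution`).

An independent `F₀` amounts to an embedding of the dual space with `Sᵏ` into jets of order below `N`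
with `C_φ`. Resonances may prevent `C_φ` from being linearized, so Jordan chains are counted
instead. On homogeneous polynomials of degree `k`, the leading part of `C_φ` is substitution of `A`.
If a Jordan chain `(S - l)ᵃ w` of `S` ends in the eigenvector `e`, the products `eᵈ (S - l)ᵃ w`
form, up to nonzero scalars, a chain of the same length for `lᵏ`, ending in a multiple of `eᵏ`.
Powers of independent functionals are independent, and `Sᵏ` has chains of the same lengths for the
`lᵏ` because `l ≠ 0`. Thus the degree `k` layer, a quotient of the jets of order at least `k`,
contains all the chains of `Sᵏ`. Passing to a quotient cannot create chains
(`finrank_ker_inf_range_pow_le_of_surjective`), so the jets contain them too, and this gives the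
embedding.

For the last claim, differentiating at `0` gives `F'(0) A = Aᵏ F'(0)`. An invertible `F'(0)` would
force `det A = (det A)ᵏ`, impossible for `k > 1` since `0 < |det A| < 1`. -/

/-! ### Jordan chains: independence, quotients, powers -/

open Module in
/-- If the ends `(T - μᵢ)^(mᵢ) zᵢ` of a family of Jordan chains are independent for each single
eigenvalue, then all the members of the chains together are linearly independent. -/
theorem linearIndependent_jordanChains {K M ι : Type*} [Field K] [IsAlgClosed K]
    [AddCommGroup M] [Module K M] [Fintype ι] (T : End K M) (μ : ι → K) (m : ι → ℕ) (z : ι → M)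
    (hz : ∀ i, ((T - μ i • (1 : End K M)) ^ (m i + 1)) (z i) = 0)
    (hs : ∀ (ν : K) (c : ι → K), (∀ i, μ i ≠ ν → c i = 0) →
      ∑ i, c i • ((T - μ i • (1 : End K M)) ^ m i) (z i) = 0 → c = 0) :
    LinearIndependent K
      (fun p : Σ i, Fin (m i + 1) => ((T - μ p.1 • (1 : End K M)) ^ (p.2 : ℕ)) (z p.1)) := by
  classical
  set b : (Σ i, Fin (m i + 1)) → M :=
    fun p => ((T - μ p.1 • (1 : End K M)) ^ (p.2 : ℕ)) (z p.1) with hb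
  set Φ : ((Σ i, Fin (m i + 1)) → K) →ₗ[K] M := Fintype.linearCombination K b with hΦ
  have Φ_apply : ∀ c, Φ c = ∑ i, ∑ a : Fin (m i + 1), c ⟨i, a⟩ • b ⟨i, a⟩ := by
    intro c
    rw [hΦ, Fintype.linearCombination_apply, Fintype.sum_sigma]
  -- The formal Jordan matrix on coefficient vectors. `Φ` intertwines it with `T` because each chain
  -- dies one step after its end.
  let J : End K ((Σ i, Fin (m i + 1)) → K) :=
    { toFun := fun c p => μ p.1 * c p + Fin.cases 0 (fun a => c ⟨p.1, a.castSucc⟩) p.2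
      map_add' := by
        rintro c d
        funext ⟨i, a⟩
        refine Fin.cases ?_ (fun a => ?_) a
        · simp [mul_add]
        · simp [mul_add]; ring
      map_smul' := by
        rintro r c
        funext ⟨i, a⟩
        refine Fin.cases ?_ (fun a => ?_) a
        · simp; ring
        · simp; ring }
  have J_zero : ∀ c i, J c ⟨i, 0⟩ = μ i * c ⟨i, 0⟩ := by
    intro c i
    change μ i * c ⟨i, 0⟩ + 0 = _
    simp
  have J_succ : ∀ c i (a : Fin (m i)),
      J c ⟨i, a.succ⟩ = μ i * c ⟨i, a.succ⟩ + c ⟨i, a.castSucc⟩ := fun c i a => rfl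
  have T_b : ∀ i (a : Fin (m i + 1)), T (b ⟨i, a⟩) =
      μ i • b ⟨i, a⟩ + ((T - μ i • (1 : End K M)) ^ ((a : ℕ) + 1)) (z i) := by
    intro i a
    rw [pow_succ', Module.End.mul_apply]
    simp [hb]
  have comm : ∀ c, Φ (J c) = T (Φ c) := by
    intro c
    rw [Φ_apply, Φ_apply, map_sum]
    refine Finset.sum_congr rfl fun i _ => ?_
    rw [map_sum]
    have h1 : ∀ a : Fin (m i + 1), T (c ⟨i, a⟩ • b ⟨i, a⟩) = (μ i * c ⟨i, a⟩) • b ⟨i, a⟩ +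
        c ⟨i, a⟩ • ((T - μ i • (1 : End K M)) ^ ((a : ℕ) + 1)) (z i) := by
      intro a
      rw [map_smul, T_b, smul_add, smul_smul, mul_comm]
    simp_rw [h1]
    rw [Finset.sum_add_distrib, Fin.sum_univ_succ, Fin.sum_univ_succ, J_zero]
    simp_rw [J_succ, add_smul]
    rw [Finset.sum_add_distrib, Fin.sum_univ_castSucc (n := m i) (f := fun a => c ⟨i, a⟩ •
      ((T - μ i • (1 : End K M)) ^ ((a : ℕ) + 1)) (z i))]
    simp only [Fin.val_last, hz, smul_zero, add_zero, Fin.val_castSucc]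
    rw [← add_assoc]
    rfl
  have key : LinearMap.ker Φ = ⊥ := by
    by_contra hne
    have hinv : ∀ c ∈ LinearMap.ker Φ, J c ∈ LinearMap.ker Φ := by
      intro c hc
      rw [LinearMap.mem_ker] at hc ⊢
      rw [comm, hc, map_zero]
    have : Nontrivial (LinearMap.ker Φ) := Submodule.nontrivial_iff_ne_bot.mpr hne
    -- An eigenvector of `J` is supported on the last slots of the chains with eigenvalue `ν`, where
    -- `hs` applies.
    obtain ⟨ν, hν⟩ := Module.End.exists_eigenvalue (J.restrict hinv)
    obtain ⟨⟨c, hc⟩, hcv⟩ := hν.exists_hasEigenvector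
    have hJc : J c = ν • c := by
      have := hcv.apply_eq_smul
      exact congrArg Subtype.val this
    have hc0 : c ≠ 0 := fun h => hcv.2 (Subtype.ext h)
    have hoff : ∀ i, μ i ≠ ν → ∀ a, c ⟨i, a⟩ = 0 := by
      intro i hi a
      induction a using Fin.induction with
      | zero =>
        have h := congrFun hJc ⟨i, 0⟩
        rw [J_zero, Pi.smul_apply, smul_eq_mul, ← sub_eq_zero, ← sub_mul] at h
        exact (mul_eq_zero.mp h).resolve_left (sub_ne_zero.mpr hi)
      | succ a ih =>
        have h := congrFun hJc ⟨i, a.succ⟩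
        rw [J_succ, ih, add_zero, Pi.smul_apply, smul_eq_mul, ← sub_eq_zero, ← sub_mul] at h
        exact (mul_eq_zero.mp h).resolve_left (sub_ne_zero.mpr hi)
    have hon : ∀ i (a : Fin (m i)), c ⟨i, a.castSucc⟩ = 0 := by
      intro i a
      by_cases hi : μ i = ν
      · have h := congrFun hJc ⟨i, a.succ⟩
        rw [J_succ, Pi.smul_apply, smul_eq_mul, hi] at h
        simpa using h
      · exact hoff i hi _
    have hlast : (fun i => c ⟨i, Fin.last _⟩) = 0 := by
      refine hs ν _ (fun i hi => hoff i hi _) ?_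
      rw [LinearMap.mem_ker, Φ_apply] at hc
      rw [← hc]
      refine Finset.sum_congr rfl fun i _ => ?_
      rw [Fin.sum_univ_castSucc]
      simp [hon, hb]
    apply hc0
    funext ⟨i, a⟩
    refine Fin.lastCases ?_ (fun a => hon i a) a
    exact congrFun hlast i
  rw [Fintype.linearIndependent_iff]
  intro g hg
  have : g ∈ LinearMap.ker Φ := by
    rw [LinearMap.mem_ker, hΦ, Fintype.linearCombination_apply, hg]
  rw [key, Submodule.mem_bot] at this
  exact fun i => congrFun this i

/-- Greedy choice of independent vectors from a decreasing sequence of subspaces. -/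
theorem exists_linearIndepOn_mem_of_card_le_finrank {K M ι : Type*} [Field K] [AddCommGroup M]
    [Module K M] [FiniteDimensional K M] (D : ℕ → Submodule K M) (m : ι → ℕ)
    (s : Finset ι) (h : ∀ j, (s.filter fun i => j ≤ m i).card ≤ Module.finrank K (D j)) :
    ∃ y : ι → M, (∀ i ∈ s, y i ∈ D (m i)) ∧ LinearIndepOn K y (s : Set ι) := by
  classical
  induction s using Finset.induction_on_min_value m with
  | empty => exact ⟨0, by simp, by simp⟩
  | insert a s ha hmin ih =>
    obtain ⟨y, hyD, hy⟩ := ih fun j =>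
      (Finset.card_le_card (Finset.filter_subset_filter _ (Finset.subset_insert a s))).trans (h j)
    -- Since `a` has the smallest value of `m`, the hypothesis at `j = m a` counts every index, so
    -- `D (m a)` is too large for the span of the vectors already chosen.
    have hcard : s.card < Module.finrank K (D (m a)) := by
      refine lt_of_lt_of_le ?_ (h (m a))
      rw [Finset.filter_true_of_mem, Finset.card_insert_of_notMem ha]
      · exact Nat.lt_succ_self _
      · intro x hx
        rcases Finset.mem_insert.mp hx with rfl | hx
        exacts [le_rfl, hmin x hx]
    have hspan : ¬ D (m a) ≤ Submodule.span K (y '' (s : Set ι)) := by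
      intro hle
      have h1 := Submodule.finrank_mono hle
      have h2 : Module.finrank K (Submodule.span K (y '' (s : Set ι))) ≤ s.card := by
        rw [← Finset.coe_image]
        exact (finrank_span_finset_le_card _).trans Finset.card_image_le
      omega
    obtain ⟨v, hvD, hv⟩ := Set.not_subset.mp hspan
    have hne : ∀ i ∈ s, i ≠ a := fun i hi h => ha (h ▸ hi)
    refine ⟨Function.update y a v, ?_, ?_⟩
    · intro i hi
      rcases Finset.mem_insert.mp hi with rfl | hi
      · simpa using hvD
      · simpa [hne i hi] using hyD i hi
    · have heq : Set.EqOn (Function.update y a v) y (s : Set ι) := fun i hi => by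
        simp [hne i hi]
      rw [Finset.coe_insert]
      refine LinearIndepOn.insert (hy.congr heq.symm) ?_
      rw [heq.image_eq]
      simpa using hv

theorem Submodule.finrank_map_add_finrank_inf_ker {K M Q : Type*} [Field K] [AddCommGroup M]
    [Module K M] [FiniteDimensional K M] [AddCommGroup Q] [Module K Q]
    (f : M →ₗ[K] Q) (P : Submodule K M) :
    Module.finrank K (P.map f) + Module.finrank K (LinearMap.ker f ⊓ P : Submodule K M) =
      Module.finrank K P := by
  have h := LinearMap.finrank_range_add_finrank_ker (f.domRestrict P)
  rw [LinearMap.range_domRestrict] at h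
  rw [← h, LinearMap.ker_domRestrict]
  congr 1
  rw [inf_comm, ← Submodule.map_comap_subtype]
  exact (LinearEquiv.finrank_eq
    (Submodule.equivMapOfInjective P.subtype P.injective_subtype _)).symm

/-- Passing to a quotient does not increase the number of Jordan chains of given length. -/
theorem finrank_ker_inf_range_pow_le_of_surjective {K M Q : Type*} [Field K] [AddCommGroup M]
    [Module K M] [FiniteDimensional K M] [AddCommGroup Q] [Module K Q]
    (π : M →ₗ[K] Q) (hπ : Function.Surjective π) (N : Module.End K M) (N' : Module.End K Q)
    (hN : ∀ x, π (N x) = N' (π x)) (j : ℕ) :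
    Module.finrank K (LinearMap.ker N' ⊓ LinearMap.range (N' ^ j) : Submodule K Q) ≤
      Module.finrank K (LinearMap.ker N ⊓ LinearMap.range (N ^ j) : Submodule K M) := by
  have : FiniteDimensional K Q := Module.Finite.of_surjective π hπ
  have hpow : ∀ j x, π ((N ^ j) x) = (N' ^ j) (π x) := by
    intro j
    induction j with
    | zero => simp
    | succ j ih => intro x; rw [pow_succ', pow_succ', Module.End.mul_apply, hN, ih]; rfl
  have hmap : ∀ j, (LinearMap.range (N ^ j)).map π = LinearMap.range (N' ^ j) := by
    intro j
    ext y
    simp only [Submodule.mem_map, LinearMap.mem_range, exists_exists_eq_and, hpow]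
    constructor
    · rintro ⟨a, ha⟩
      exact ⟨_, ha⟩
    · rintro ⟨b, hb⟩
      obtain ⟨a, rfl⟩ := hπ b
      exact ⟨a, hb⟩
  have hN1 : (LinearMap.range (N ^ j)).map N = LinearMap.range (N ^ (j + 1)) := by
    rw [pow_succ', Module.End.mul_eq_comp, LinearMap.range_comp]
  have hN2 : (LinearMap.range (N' ^ j)).map N' = LinearMap.range (N' ^ (j + 1)) := by
    rw [pow_succ', Module.End.mul_eq_comp, LinearMap.range_comp]
  -- `ker N ⊓ range Nʲ` has dimension `rank Nʲ - rank Nʲ⁺¹`, and likewise for `N'`. The two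
  -- dimensions differ by that of `ker π ⊓ range Nʲ` minus that of `ker π ⊓ range Nʲ⁺¹`, which is
  -- nonnegative.
  have e1 := Submodule.finrank_map_add_finrank_inf_ker N (LinearMap.range (N ^ j))
  have e2 := Submodule.finrank_map_add_finrank_inf_ker N' (LinearMap.range (N' ^ j))
  have e3 := Submodule.finrank_map_add_finrank_inf_ker π (LinearMap.range (N ^ j))
  have e4 := Submodule.finrank_map_add_finrank_inf_ker π (LinearMap.range (N ^ (j + 1)))
  have hle : (LinearMap.ker π ⊓ LinearMap.range (N ^ (j + 1)) : Submodule K M) ≤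
      LinearMap.ker π ⊓ LinearMap.range (N ^ j) := by
    refine inf_le_inf_left _ ?_
    rintro _ ⟨x, rfl⟩
    exact ⟨N x, by rw [pow_succ, Module.End.mul_apply]⟩
  have e5 := Submodule.finrank_mono hle
  rw [hmap] at e3 e4
  rw [hN1] at e1
  rw [hN2] at e2
  omega

open Module in
/-- Jordan chains with independent ends in a quotient of `M` can be replaced by Jordan chains in
`M` with the same eigenvalues and lengths, with ends independent for each eigenvalue. -/
theorem exists_jordanChains_of_surjective {K M Q ι : Type*} [Field K] [AddCommGroup M]
    [Module K M] [FiniteDimensional K M] [AddCommGroup Q] [Module K Q] [Fintype ι]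
    (π : M →ₗ[K] Q) (hπ : Function.Surjective π) (T : End K M) (T' : End K Q)
    (hT : ∀ x, π (T x) = T' (π x)) (μ : ι → K) (m : ι → ℕ) (x : ι → Q)
    (hx : ∀ i, ((T' - μ i • (1 : End K Q)) ^ (m i + 1)) (x i) = 0)
    (hli : LinearIndependent K fun i => ((T' - μ i • (1 : End K Q)) ^ m i) (x i)) :
    ∃ z : ι → M, (∀ i, ((T - μ i • (1 : End K M)) ^ (m i + 1)) (z i) = 0) ∧
      ∀ (ν : K) (c : ι → K), (∀ i, μ i ≠ ν → c i = 0) →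
        ∑ i, c i • ((T - μ i • (1 : End K M)) ^ m i) (z i) = 0 → c = 0 := by
  classical
  have : FiniteDimensional K Q := Module.Finite.of_surjective π hπ
  have main : ∀ ν : K, ∃ y : ι → M,
      (∀ i, μ i = ν → y i ∈ (LinearMap.ker (T - ν • (1 : End K M)) ⊓
        LinearMap.range ((T - ν • (1 : End K M)) ^ m i) : Submodule K M)) ∧
      LinearIndepOn K y {i | μ i = ν} := by
    intro ν
    obtain ⟨y, h1, h2⟩ := exists_linearIndepOn_mem_of_card_le_finrank
      (fun j => (LinearMap.ker (T - ν • (1 : End K M)) ⊓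
        LinearMap.range ((T - ν • (1 : End K M)) ^ j) : Submodule K M)) m
      (Finset.univ.filter fun i => μ i = ν) (by
        intro j
        refine le_trans ?_ (finrank_ker_inf_range_pow_le_of_surjective π hπ
          (T - ν • (1 : End K M)) (T' - ν • (1 : End K Q)) (by simp [hT]) j)
        -- The chains in `Q` for `ν` of length greater than `j`: their ends are independent in `ker
        -- ⊓ range` of the quotient operator, which bounds their number.
        set s := ((Finset.univ.filter fun i => μ i = ν).filter fun i => j ≤ m i) with hs
        have hmem : ∀ i ∈ s, ((T' - μ i • (1 : End K Q)) ^ m i) (x i) ∈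
            (LinearMap.ker (T' - ν • (1 : End K Q)) ⊓
              LinearMap.range ((T' - ν • (1 : End K Q)) ^ j) : Submodule K Q) := by
          intro i hi
          simp only [hs, Finset.mem_filter, Finset.mem_univ, true_and] at hi
          obtain ⟨hi, hj⟩ := hi
          subst hi
          refine ⟨?_, ?_⟩
          · rw [SetLike.mem_coe, LinearMap.mem_ker, ← Module.End.mul_apply, ← pow_succ', hx]
          · refine ⟨((T' - μ i • (1 : End K Q)) ^ (m i - j)) (x i), ?_⟩
            rw [← Module.End.mul_apply, ← pow_add, Nat.add_sub_cancel' hj]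
        have hli' : LinearIndependent K (fun i : s =>
            (⟨_, hmem i i.2⟩ : (LinearMap.ker (T' - ν • (1 : End K Q)) ⊓
              LinearMap.range ((T' - ν • (1 : End K Q)) ^ j) : Submodule K Q))) := by
          refine LinearIndependent.of_comp (Submodule.subtype _) ?_
          exact hli.comp (fun i : s => (i : ι)) Subtype.val_injective
        simpa using hli'.fintype_card_le_finrank)
    refine ⟨y, fun i hi => h1 i (by simpa using hi), ?_⟩
    simpa using h2
  choose y hyD hy using main
  have hz : ∀ i, ∃ z, ((T - μ i • (1 : End K M)) ^ m i) z = y (μ i) i := fun i => (hyD _ i rfl).2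
  choose z hz using hz
  refine ⟨z, fun i => ?_, fun ν c hc h => ?_⟩
  · rw [pow_succ', Module.End.mul_apply, hz]
    exact LinearMap.mem_ker.mp (hyD _ i rfl).1
  · have h0 := linearIndepOn_finset_iff.mp
      (by simpa using hy ν : LinearIndepOn K (y ν)
        ((Finset.univ.filter fun i => μ i = ν : Finset ι) : Set ι)) c (by
      rw [← h, Finset.sum_filter]
      refine Finset.sum_congr rfl fun i _ => ?_
      split_ifs with hi
      · rw [hz, hi]
      · rw [hc i hi, zero_smul])
    funext i
    by_cases hi : μ i = ν
    · exact h0 i (by simpa using hi)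
    · exact hc i hi

open Module Polynomial in
/-- Jordan normal form, as a family of Jordan chains whose total length is the dimension. -/
theorem exists_jordanChains {K W : Type*} [Field K] [IsAlgClosed K] [AddCommGroup W] [Module K W]
    [FiniteDimensional K W] (S : End K W) :
    ∃ (r : ℕ) (l : Fin r → K) (m : Fin r → ℕ) (w : Fin r → W),
      (∀ i, ((S - l i • (1 : End K W)) ^ (m i + 1)) (w i) = 0) ∧
      (LinearIndependent K fun i => ((S - l i • (1 : End K W)) ^ m i) (w i)) ∧
      ∑ i, (m i + 1) = finrank K W := by
  classical
  obtain ⟨ι, _, p, hp, e, ⟨f⟩⟩ := Module.equiv_directSum_of_isTorsion (R := K[X])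
    (M := AEval' S) (AEval.isTorsion_of_finiteDimensional K W S)
  have hroot : ∀ i, ∃ a : K, Associated (p i) (X - C a) := by
    intro i
    obtain ⟨a, ha⟩ := exists_root_of_degree_eq_one
      (IsAlgClosed.degree_eq_one_of_irreducible K (hp i))
    exact ⟨a, ((irreducible_X_sub_C a).associated_of_dvd (hp i) (dvd_iff_isRoot.mpr ha)).symm⟩
  choose l hl using hroot
  have hspan : ∀ i, (K[X] ∙ (p i ^ e i)) = Ideal.span {(X - C (l i)) ^ e i} := fun i =>
    Ideal.span_singleton_eq_span_singleton.mpr ((hl i).pow_pow)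
  set of := AEval'.of S with hof
  -- The class of `1` in the cyclic summand `K[X] / (X - l)^e` starts a chain of length `e`.
  let g : ∀ i, AEval' S := fun i => f.symm (DirectSum.lof K[X] ι
    (fun i => K[X] ⧸ (K[X] ∙ p i ^ e i)) i (Submodule.Quotient.mk 1))
  let w : ι → W := fun i => of.symm (g i)
  have act : ∀ (a : K) (n : ℕ) (v : W), of (((S - a • (1 : End K W)) ^ n) v) =
      ((X - C a) ^ n : K[X]) • of v := by
    intro a n v
    rw [← AEval.of_aeval_smul]
    congr 1
    simp [Algebra.algebraMap_eq_smul_one]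
  have fact : ∀ (q : K[X]) i, f (q • of (w i)) = DirectSum.lof K[X] ι
      (fun i => K[X] ⧸ (K[X] ∙ p i ^ e i)) i (Submodule.Quotient.mk q) := by
    intro q i
    rw [map_smul]
    simp only [w, g, LinearEquiv.apply_symm_apply]
    rw [← map_smul, ← Submodule.Quotient.mk_smul, smul_eq_mul, mul_one]
  have fzero : ∀ (q : K[X]) i, (X - C (l i)) ^ e i ∣ q → q • of (w i) = 0 := by
    intro q i hq
    apply f.injective
    rw [fact, map_zero, (Submodule.Quotient.mk_eq_zero _).mpr, map_zero]
    rw [hspan]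
    exact Ideal.mem_span_singleton.mpr hq
  -- Summands with exponent `0` are trivial and are dropped, so that `e - 1` is a genuine
  -- predecessor.
  let σ := (Fintype.equivFin {i // e i ≠ 0}).symm
  refine ⟨Fintype.card {i // e i ≠ 0}, fun i => l (σ i), fun i => e (σ i) - 1, fun i => w (σ i),
    fun i => ?_, ?_, ?_⟩
  · apply of.injective
    rw [act, map_zero]
    exact fzero _ _ (pow_dvd_pow _ (by have := (σ i).2; dsimp only; omega))
  · rw [Fintype.linearIndependent_iff]
    intro c hc j
    have h1 : ∑ i, (C (c i) * (X - C (l (σ i))) ^ (e (σ i) - 1) : K[X]) • of (w (σ i)) = 0 := by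
      rw [← map_zero of, ← hc, map_sum]
      refine Finset.sum_congr rfl fun i _ => ?_
      rw [map_smul, act, mul_smul, ← algebraMap_eq, algebraMap_smul]
    have h2 := congrArg (fun v => DirectSum.component K[X] ι
      (fun i => K[X] ⧸ (K[X] ∙ p i ^ e i)) (σ j) (f v)) h1
    simp only [map_sum, fact, map_zero] at h2
    rw [Finset.sum_eq_single j, DirectSum.component.lof_self,
      Submodule.Quotient.mk_eq_zero, hspan] at h2
    · by_contra hcj
      have h3 := Ideal.mem_span_singleton.mp h2
      have h4 := degree_le_of_dvd h3 (mul_ne_zero (C_ne_zero.mpr hcj)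
        (pow_ne_zero _ (X_sub_C_ne_zero _)))
      rw [degree_C_mul hcj, degree_pow, degree_pow, degree_X_sub_C] at h4
      have := (σ j).2
      simp only [nsmul_eq_mul, mul_one, Nat.cast_le] at h4
      omega
    · intro b _ hb
      rw [DirectSum.component.of, dif_neg]
      exact fun h => hb (σ.injective (Subtype.ext h))
    · simp
  · have h1 : ∑ i, (e (σ i) - 1 + 1) = ∑ i : {i // e i ≠ 0}, e i := by
      rw [← Equiv.sum_comp σ]
      exact Finset.sum_congr rfl fun i _ => Nat.succ_pred_eq_of_ne_zero (σ i).2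
    rw [h1, of.finrank_eq, (f.restrictScalars K).finrank_eq]
    have hfin : ∀ i, Module.Finite K (K[X] ⧸ (K[X] ∙ p i ^ e i)) := by
      intro i
      rw [hspan]
      exact ((monic_X_sub_C (l i)).pow (e i)).finite_quotient
    rw [Module.finrank_directSum]
    have h2 : ∀ i, finrank K (K[X] ⧸ (K[X] ∙ p i ^ e i)) = e i := by
      intro i
      rw [hspan, finrank_quotient_span_eq_natDegree, natDegree_pow, natDegree_X_sub_C, mul_one]
    simp_rw [h2]
    rw [← Finset.sum_subtype (Finset.univ.filter fun i => e i ≠ 0) (by simp) e]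
    exact Finset.sum_filter_ne_zero _

open Module in
/-- A Jordan chain of `A` for a nonzero eigenvalue `l` is, up to a nonzero factor at its end, also
a Jordan chain of `A ^ k` for the eigenvalue `l ^ k`. -/
theorem pow_sub_smul_one_pow_apply {K W : Type*} [Field K] [AddCommGroup W] [Module K W]
    (A : End K W) (l : K) (m k : ℕ) (w : W)
    (hw : ((A - l • (1 : End K W)) ^ (m + 1)) w = 0) :
    ((A ^ k - l ^ k • (1 : End K W)) ^ (m + 1)) w = 0 ∧
    ((A ^ k - l ^ k • (1 : End K W)) ^ m) w =
      ((k : K) * l ^ (k - 1)) ^ m • ((A - l • (1 : End K W)) ^ m) w := by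
  set N := A - l • (1 : End K W) with hN
  -- The cofactor in `Aᵏ - lᵏ = U (A - l)`; on the eigenvector ending the chain it is the scalar `k
  -- lᵏ⁻¹`.
  set U : End K W := ∑ i ∈ Finset.range k, A ^ i * (l • (1 : End K W)) ^ (k - 1 - i) with hU
  have hcomm : Commute A (l • (1 : End K W)) := (Commute.one_right A).smul_right l
  have hfac : A ^ k - l ^ k • (1 : End K W) = U * N := by
    rw [hU, hN, hcomm.geom_sum₂_mul, smul_pow, one_pow]
  have hUN : Commute U N := by
    refine Commute.sum_left _ _ _ fun i _ => ?_
    have h1 : Commute A N := (Commute.refl A).sub_right hcomm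
    have h2 : Commute (l • (1 : End K W)) N := hcomm.symm.sub_right (Commute.refl _)
    exact (h1.pow_left _).mul_left (h2.pow_left _)
  have hA : A ((N ^ m) w) = l • (N ^ m) w := by
    have h : N ((N ^ m) w) = 0 := by rw [← Module.End.mul_apply, ← pow_succ', hw]
    rw [hN, LinearMap.sub_apply, sub_eq_zero] at h
    simpa using h
  have hApow : ∀ i, (A ^ i) ((N ^ m) w) = l ^ i • (N ^ m) w := by
    intro i
    induction i with
    | zero => simp
    | succ i ih => rw [pow_succ, Module.End.mul_apply, hA, map_smul, ih, smul_smul, pow_succ']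
  have hUw : U ((N ^ m) w) = ((k : K) * l ^ (k - 1)) • (N ^ m) w := by
    rw [hU, LinearMap.sum_apply, Finset.sum_congr rfl (g := fun _ => l ^ (k - 1) • (N ^ m) w)]
    · rw [Finset.sum_const, Finset.card_range, ← Nat.cast_smul_eq_nsmul K, smul_smul]
    · intro i hi
      have := Finset.mem_range.mp hi
      rw [smul_pow, one_pow, mul_smul_comm, mul_one, LinearMap.smul_apply, hApow, smul_smul,
        ← pow_add]
      congr 2
      omega
  have hUpow : ∀ i, (U ^ i) ((N ^ m) w) = ((k : K) * l ^ (k - 1)) ^ i • (N ^ m) w := by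
    intro i
    induction i with
    | zero => simp
    | succ i ih => rw [pow_succ, Module.End.mul_apply, hUw, map_smul, ih, smul_smul, pow_succ']
  rw [hfac, hUN.mul_pow, hUN.mul_pow]
  refine ⟨?_, ?_⟩
  · rw [Module.End.mul_apply, hw, map_zero]
  · rw [Module.End.mul_apply, hUpow]

open Module in
/-- Let `W` carry an operator `S` with Jordan chains `wᵢ`. If the quotient of `(X, T)` by `L₁`
contains independent chains of the same type, then `(W, S)` embeds into the quotient of `(X, T)` by
any smaller invariant subspace `L₂` of finite codimension. -/
theorem exists_linearMap_intertwining_mod {K X W ι : Type*} [Field K] [IsAlgClosed K]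
    [AddCommGroup X] [Module K X] [AddCommGroup W] [Module K W] [FiniteDimensional K W] [Fintype ι]
    (T : End K X) (L₁ L₂ : Submodule K X) (hL : L₂ ≤ L₁) (hT₁ : ∀ x ∈ L₁, T x ∈ L₁)
    (hT₂ : ∀ x ∈ L₂, T x ∈ L₂) [FiniteDimensional K (X ⧸ L₂)]
    (S : End K W) (μ : ι → K) (m : ι → ℕ) (w : ι → W) (x : ι → X)
    (hw : ∀ i, ((S - μ i • (1 : End K W)) ^ (m i + 1)) (w i) = 0)
    (hwi : LinearIndependent K fun i => ((S - μ i • (1 : End K W)) ^ m i) (w i))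
    (hdim : ∑ i, (m i + 1) = finrank K W)
    (hx : ∀ i, ((T - μ i • (1 : End K X)) ^ (m i + 1)) (x i) ∈ L₁)
    (hxi : LinearIndependent K fun i => L₁.mkQ (((T - μ i • (1 : End K X)) ^ m i) (x i))) :
    ∃ f : W →ₗ[K] X, (∀ v, T (f v) - f (S v) ∈ L₂) ∧ ∀ v, f v ∈ L₂ → v = 0 := by
  classical
  have pow_mkQ : ∀ (L : Submodule K X) (h : ∀ x ∈ L, T x ∈ L) (a : K) (n : ℕ) (y : X),
      L.mkQ (((T - a • (1 : End K X)) ^ n) y) =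
        ((L.mapQ L T h - a • (1 : End K (X ⧸ L))) ^ n) (L.mkQ y) := by
    intro L h a n
    induction n with
    | zero => simp
    | succ n ih =>
      intro y
      rw [pow_succ, pow_succ, Module.End.mul_apply, Module.End.mul_apply, ih]
      simp
  obtain ⟨z', hz', hz'i⟩ := exists_jordanChains_of_surjective (Submodule.factor hL)
    (Submodule.factor_surjective hL) (L₂.mapQ L₂ T hT₂) (L₁.mapQ L₁ T hT₁)
    (by
      intro y
      obtain ⟨y, rfl⟩ := L₂.mkQ_surjective y
      simp) μ m (fun i => L₁.mkQ (x i))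
    (fun i => by
      rw [← pow_mkQ, Submodule.mkQ_apply, Submodule.Quotient.mk_eq_zero]
      exact hx i)
    (by simpa only [← pow_mkQ] using hxi)
  choose z hz using fun i => L₂.mkQ_surjective (z' i)
  have hind := linearIndependent_jordanChains _ μ m z' hz' hz'i
  have hbi := linearIndependent_jordanChains S μ m w hw (by
    intro ν c _ h
    exact funext (Fintype.linearIndependent_iff.mp hwi c h))
  let b : Basis (Σ i, Fin (m i + 1)) K W :=
    basisOfLinearIndependentOfCardEqFinrank' _ hbi (by simp [hdim])
  have hb : ∀ i (a : Fin (m i + 1)),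
      b ⟨i, a⟩ = ((S - μ i • (1 : End K W)) ^ (a : ℕ)) (w i) := fun i a =>
    congrFun (coe_basisOfLinearIndependentOfCardEqFinrank' _ hbi _) ⟨i, a⟩
  let f : W →ₗ[K] X := b.constr K fun p => ((T - μ p.1 • (1 : End K X)) ^ (p.2 : ℕ)) (z p.1)
  have hf : ∀ i (a : Fin (m i + 1)),
      f (b ⟨i, a⟩) = ((T - μ i • (1 : End K X)) ^ (a : ℕ)) (z i) := fun i a =>
    b.constr_basis K _ _
  have hfQ : ∀ p, (L₂.mkQ ∘ₗ f) (b p) =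
      ((L₂.mapQ L₂ T hT₂ - μ p.1 • (1 : End K (X ⧸ L₂))) ^ (p.2 : ℕ)) (z' p.1) := by
    rintro ⟨i, a⟩
    rw [LinearMap.comp_apply, hf, pow_mkQ L₂ hT₂, hz]
  refine ⟨f, fun v => ?_, fun v hv => ?_⟩
  · have hD : L₂.mkQ ∘ₗ (T ∘ₗ f - f ∘ₗ S) = 0 := by
      refine b.ext ?_
      rintro ⟨i, a⟩
      have hS : S (b ⟨i, a⟩) = ((S - μ i • (1 : End K W)) ^ ((a : ℕ) + 1)) (w i) +
          μ i • b ⟨i, a⟩ := by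
        rw [pow_succ', Module.End.mul_apply, ← hb]
        simp
      have hTf : T (f (b ⟨i, a⟩)) = ((T - μ i • (1 : End K X)) ^ ((a : ℕ) + 1)) (z i) +
          μ i • f (b ⟨i, a⟩) := by
        rw [pow_succ', Module.End.mul_apply, ← hf]
        simp
      have hdiff : (T ∘ₗ f - f ∘ₗ S) (b ⟨i, a⟩) =
          ((T - μ i • (1 : End K X)) ^ ((a : ℕ) + 1)) (z i) -
            f (((S - μ i • (1 : End K W)) ^ ((a : ℕ) + 1)) (w i)) := by
        rw [LinearMap.sub_apply, LinearMap.comp_apply, LinearMap.comp_apply, hTf, hS, map_add,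
          map_smul]
        abel
      rw [LinearMap.comp_apply, hdiff, LinearMap.zero_apply]
      -- Inside a chain the intertwining is exact; at its end the error is `(T - μ)^(m + 1) z`,
      -- which lies in `L₂`.
      refine Fin.lastCases ?_ (fun a => ?_) a
      · rw [Fin.val_last, hw, map_zero, sub_zero, pow_mkQ L₂ hT₂, hz, hz']
      · have h1 := hf i a.succ
        rw [hb, Fin.val_succ] at h1
        rw [Fin.val_castSucc, h1, sub_self, map_zero]
    have := LinearMap.congr_fun hD v
    rwa [LinearMap.comp_apply, LinearMap.zero_apply, Submodule.mkQ_apply,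
      Submodule.Quotient.mk_eq_zero] at this
  · have h0 : (L₂.mkQ ∘ₗ f) v = 0 := by
      rwa [LinearMap.comp_apply, Submodule.mkQ_apply, Submodule.Quotient.mk_eq_zero]
    rw [← b.sum_repr v, map_sum] at h0
    simp_rw [map_smul, hfQ] at h0
    have h1 := Fintype.linearIndependent_iff.mp hind _ h0
    rw [← b.sum_repr v]
    exact Finset.sum_eq_zero fun p _ => by rw [h1 p, zero_smul]

/-! ### Taylor series of bounded analytic functions and sums of such functions -/

/-- Iterated Cauchy estimate. -/
theorem norm_iteratedFDeriv_le_of_norm_le {E G : Type*} [NormedAddCommGroup E] [NormedSpace ℂ E]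
    [NormedAddCommGroup G] [NormedSpace ℂ G] [CompleteSpace G] {f : E → G} {c : E} {r C h : ℝ}
    (hf : AnalyticOnNhd ℂ f (ball c r)) (hC : ∀ z ∈ ball c r, ‖f z‖ ≤ C) (hh : 0 < h) (m : ℕ) :
    ∀ z ∈ ball c (r - m * h), ‖iteratedFDeriv ℂ m f z‖ ≤ C * (2 / h) ^ m := by
  induction m with
  | zero => simpa using hC
  | succ m ih =>
    intro z hz
    have hsub : ball z h ⊆ ball c (r - m * h) := by
      refine ball_subset_ball' ?_
      rw [mem_ball] at hz
      push_cast at hz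
      linarith
    have hzm : z ∈ ball c (r - m * h) := hsub (mem_ball_self hh)
    have hmr : ball c (r - m * h) ⊆ ball c r := ball_subset_ball (by
      have : 0 ≤ m * h := by positivity
      linarith)
    have hd : DifferentiableOn ℂ (iteratedFDeriv ℂ m f) (ball z h) := fun y hy =>
      ((hf.iteratedFDeriv m) y (hmr (hsub hy))).differentiableAt.differentiableWithinAt
    rw [← norm_fderiv_iteratedFDeriv]
    -- The Cauchy bound needs a ball about the central value, hence the doubled radius and the
    -- factor `2 / h`.
    have hmaps : Set.MapsTo (iteratedFDeriv ℂ m f) (ball z h)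
        (closedBall (iteratedFDeriv ℂ m f z) (2 * (C * (2 / h) ^ m))) := by
      intro y hy
      rw [mem_closedBall, dist_eq_norm]
      refine (norm_sub_le _ _).trans ?_
      linarith [ih y (hsub hy), ih z hzm]
    refine (Complex.norm_fderiv_le_div_of_mapsTo_ball hd hmaps hh).trans (le_of_eq ?_)
    rw [pow_succ]
    ring

/-- The Taylor coefficients of a bounded analytic function on a ball. -/
theorem norm_taylor_le_of_norm_le {E G : Type*} [NormedAddCommGroup E] [NormedSpace ℂ E]
    [NormedAddCommGroup G] [NormedSpace ℂ G] [CompleteSpace G] {f : E → G} {c : E} {r C : ℝ}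
    (hr : 0 < r) (hf : AnalyticOnNhd ℂ f (ball c r)) (hC : ∀ z ∈ ball c r, ‖f z‖ ≤ C) (m : ℕ) :
    ‖((m.factorial : ℂ)⁻¹ • iteratedFDeriv ℂ m f c)‖ ≤ C * (4 * Real.exp 1 / r) ^ m := by
  have hC0 : 0 ≤ C := (norm_nonneg _).trans (hC c (mem_ball_self hr))
  rcases Nat.eq_zero_or_pos m with rfl | hm
  · simpa using hC c (mem_ball_self hr)
  have hm' : (0 : ℝ) < m := Nat.cast_pos.mpr hm
  -- With `h = r / (2m)` the `m` steps use only half of the radius, and the resulting `mᵐ / m!` is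
  -- at most `eᵐ`.
  have h1 := norm_iteratedFDeriv_le_of_norm_le hf hC (h := r / (2 * m)) (by positivity) m c
    (mem_ball_self (by
      have : (m : ℝ) * (r / (2 * m)) = r / 2 := by field_simp
      linarith))
  have h2 : (m : ℝ) ^ m / m.factorial ≤ Real.exp 1 ^ m := by
    rw [← Real.exp_nat_mul, mul_one]
    exact Real.pow_div_factorial_le_exp _ hm'.le _
  rw [norm_smul, norm_inv, Complex.norm_natCast]
  calc (m.factorial : ℝ)⁻¹ * ‖iteratedFDeriv ℂ m f c‖
      ≤ (m.factorial : ℝ)⁻¹ * (C * (2 / (r / (2 * m))) ^ m) := by gcongr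
    _ = C * ((4 / r) ^ m * ((m : ℝ) ^ m / m.factorial)) := by
        rw [show 2 / (r / (2 * (m : ℝ))) = 4 / r * m by field_simp; norm_num, mul_pow]
        ring
    _ ≤ C * ((4 / r) ^ m * Real.exp 1 ^ m) := by gcongr
    _ = C * (4 * Real.exp 1 / r) ^ m := by rw [← mul_pow]; ring

/-- A bounded analytic function on a ball is the sum of its Taylor series on a smaller ball. -/
theorem hasSum_taylor_of_norm_le {E G : Type*} [NormedAddCommGroup E] [NormedSpace ℂ E]
    [NormedAddCommGroup G] [NormedSpace ℂ G] [CompleteSpace G] {f : E → G} {c : E} {r C : ℝ}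
    (hr : 0 < r) (hf : AnalyticOnNhd ℂ f (ball c r)) (hC : ∀ z ∈ ball c r, ‖f z‖ ≤ C)
    {y : E} (hy : ‖y‖ < r / (4 * Real.exp 1)) :
    HasSum (fun m => ((m.factorial : ℂ)⁻¹ • iteratedFDeriv ℂ m f c) fun _ => y) (f (c + y)) := by
  set p : FormalMultilinearSeries ℂ E G :=
    fun m => (m.factorial : ℂ)⁻¹ • iteratedFDeriv ℂ m f c with hp
  have hρ : 0 < r / (4 * Real.exp 1) := by positivity
  have hrad : ENNReal.ofReal (r / (4 * Real.exp 1)) ≤ p.radius := by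
    refine p.le_radius_of_bound C fun m => ?_
    rw [Real.coe_toNNReal _ hρ.le]
    calc ‖p m‖ * (r / (4 * Real.exp 1)) ^ m
        ≤ C * (4 * Real.exp 1 / r) ^ m * (r / (4 * Real.exp 1)) ^ m := by
          gcongr
          exact norm_taylor_le_of_norm_le hr hf hC m
      _ = C := by
          rw [mul_assoc, ← mul_pow]
          field_simp
          simp
  have hpos : 0 < p.radius := lt_of_lt_of_le (ENNReal.ofReal_pos.mpr hρ) hrad
  have hps := (p.hasFPowerSeriesOnBall hpos).mono (ENNReal.ofReal_pos.mpr hρ) hrad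
  have hsum : AnalyticOnNhd ℂ p.sum (ball 0 (r / (4 * Real.exp 1))) := by
    have := hps.analyticOnNhd
    rwa [eball_ofReal] at this
  have hle : r / (4 * Real.exp 1) ≤ r := by
    refine div_le_self hr.le ?_
    have := Real.add_one_le_exp (1 : ℝ)
    linarith
  have hshift : AnalyticOnNhd ℂ (fun y => f (c + y)) (ball 0 (r / (4 * Real.exp 1))) := by
    intro y hy
    refine AnalyticAt.fun_comp (hf (c + y) ?_) (analyticAt_const.add analyticAt_id)
    rw [mem_ball_zero_iff] at hy
    rw [mem_ball, dist_eq_norm, add_sub_cancel_left]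
    exact hy.trans_le hle
  -- The Taylor series represents `f` near `c`; the identity theorem carries this to the whole
  -- smaller ball.
  have heq : p.sum =ᶠ[𝓝 0] fun y => f (c + y) := by
    obtain ⟨q, R, hq⟩ := hf c (mem_ball_self hr)
    have : eball (0 : E) R ∈ 𝓝 (0 : E) := Metric.eball_mem_nhds _ hq.r_pos
    filter_upwards [this] with y hy
    exact (hq.hasSum_iteratedFDeriv hy).tsum_eq
  have hEq := hsum.eqOn_of_preconnected_of_eventuallyEq hshift
    (convex_ball (0 : E) _).isPreconnected (mem_ball_self hρ) heq
  have hyb : y ∈ ball (0 : E) (r / (4 * Real.exp 1)) := by simpa using hy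
  have h := hps.hasSum (y := y) (by rwa [eball_ofReal])
  rw [zero_add, hEq hyb] at h
  exact h

/-- The sum of a series of analytic functions with summable bounds on a ball is analytic. -/
theorem analyticAt_tsum_of_summable_norm_le {E G : Type*} [NormedAddCommGroup E] [NormedSpace ℂ E]
    [NormedAddCommGroup G] [NormedSpace ℂ G] [CompleteSpace G] {f : ℕ → E → G} {c : E} {r : ℝ}
    {u : ℕ → ℝ} (hr : 0 < r) (hu : Summable u) (hf : ∀ j, AnalyticOnNhd ℂ (f j) (ball c r))
    (hfu : ∀ j, ∀ z ∈ ball c r, ‖f j z‖ ≤ u j) : AnalyticAt ℂ (fun z => ∑' j, f j z) c := by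
  have hu0 : ∀ j, 0 ≤ u j := fun j => (norm_nonneg _).trans (hfu j c (mem_ball_self hr))
  set q : ℝ := 4 * Real.exp 1 / r with hq
  have hq0 : 0 < q := by positivity
  set p : ℕ → FormalMultilinearSeries ℂ E G :=
    fun j m => (m.factorial : ℂ)⁻¹ • iteratedFDeriv ℂ m (f j) c with hp
  have hpb : ∀ j m, ‖p j m‖ ≤ u j * q ^ m := fun j m =>
    norm_taylor_le_of_norm_le hr (hf j) (hfu j) m
  have hptaylor : ∀ j (y : E), ‖y‖ < r / (4 * Real.exp 1) →
      HasSum (fun m => p j m fun _ => y) (f j (c + y)) := fun j y hy =>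
    hasSum_taylor_of_norm_le hr (hf j) (hfu j) hy
  clear_value p
  have hps : ∀ m, Summable fun j => p j m := fun m =>
    Summable.of_norm_bounded (hu.mul_right (q ^ m)) fun j => hpb j m
  set P : FormalMultilinearSeries ℂ E G := fun m => ∑' j, p j m with hP
  have hPb : ∀ m, ‖P m‖ ≤ (∑' j, u j) * q ^ m := fun m =>
    (tsum_of_norm_bounded (hu.hasSum.mul_right (q ^ m)) fun j => hpb j m)
  -- Half of `1 / q`, so that the double series is dominated by `u j * 2⁻ᵐ` and may be summed in
  -- either order.
  set ρ : ℝ := 1 / (2 * q) with hρ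
  have hρ0 : 0 < ρ := by positivity
  refine ⟨P, ENNReal.ofReal ρ, ?_, ENNReal.ofReal_pos.mpr hρ0, ?_⟩
  · refine P.le_radius_of_bound (∑' j, u j) fun m => ?_
    rw [Real.coe_toNNReal _ hρ0.le]
    calc ‖P m‖ * ρ ^ m ≤ (∑' j, u j) * q ^ m * ρ ^ m := by gcongr; exact hPb m
      _ = (∑' j, u j) * (1 / 2) ^ m := by
          rw [mul_assoc, ← mul_pow, hρ]
          congr 2
          field_simp
      _ ≤ ∑' j, u j := mul_le_of_le_one_right (tsum_nonneg hu0)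
          (pow_le_one₀ (by norm_num) (by norm_num))
  · intro y hy
    rw [eball_ofReal, mem_ball_zero_iff] at hy
    have hyr : ‖y‖ < r / (4 * Real.exp 1) := by
      refine hy.trans_le ?_
      rw [hρ, hq, div_le_div_iff₀ (by positivity) (by positivity)]
      field_simp
      norm_num
    have hterm : ∀ j m, ‖p j m fun _ => y‖ ≤ u j * (1 / 2) ^ m := by
      intro j m
      refine ((p j m).le_opNorm _).trans ?_
      rw [Finset.prod_const, Finset.card_univ, Fintype.card_fin]
      calc ‖p j m‖ * ‖y‖ ^ m ≤ u j * q ^ m * ρ ^ m := by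
            have := hu0 j
            gcongr
            exact hpb j m
        _ = u j * (1 / 2) ^ m := by
          rw [mul_assoc, ← mul_pow, hρ]
          congr 2
          field_simp
    have hsm : Summable fun x : ℕ × ℕ => p x.1 x.2 fun _ => y := by
      refine Summable.of_norm_bounded (g := fun x : ℕ × ℕ => u x.1 * (1 / 2) ^ x.2) ?_
        fun x => hterm x.1 x.2
      exact hu.mul_of_nonneg (summable_geometric_of_lt_one (by norm_num) (by norm_num)) hu0
        fun m => by positivity
    have hsw : HasSum (fun x : ℕ × ℕ => p x.2 x.1 fun _ => y) (∑' j, f j (c + y)) := by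
      have h1 := hsm.hasSum
      have h2 := h1.prod_fiberwise fun j => hptaylor j y hyr
      rw [h2.tsum_eq]
      exact (Equiv.prodComm ℕ ℕ).hasSum_iff.mpr h1
    have hPy : ∀ m, HasSum (fun j => p j m fun _ => y) (P m fun _ => y) := fun m =>
      (hps m).hasSum.mapL (ContinuousMultilinearMap.apply ℂ (fun _ : Fin m => E) G fun _ => y)
    exact hsw.prod_fiberwise hPy

/-! ### Strict Schwarz estimates -/

theorem IsAnalyticSelfMap.norm_fderiv_le_one {n : ℕ} {φ : Cn n → Cn n}
    (hφ : IsAnalyticSelfMap φ) (hφ0 : φ 0 = 0) : ‖fderiv ℂ φ 0‖ ≤ 1 := by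
  have h := Complex.norm_fderiv_le_div_of_mapsTo_ball (c := (0 : Cn n)) (R₁ := 1) (R₂ := 1)
    hφ.analytic.differentiableOn (by
      rw [hφ0]
      exact hφ.mapsTo.mono_right ball_subset_closedBall) one_pos
  simpa using h

/-- If equality holds in the Schwarz lemma along a slice then `φ` is unitary on that slice. -/
theorem IsAnalyticSelfMap.isUnitaryOnSomeSlice_of_norm_dslope_eq_one {n : ℕ} {φ : Cn n → Cn n}
    (hφ : IsAnalyticSelfMap φ) (hφ0 : φ 0 = 0) {ζ : Cn n} (hζ : ‖ζ‖ = 1) {t₀ : ℂ} (ht₀ : ‖t₀‖ < 1)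
    (h : ‖dslope (fun t : ℂ => φ (t • ζ)) 0 t₀‖ = 1) : IsUnitaryOnSomeSlice φ := by
  set g : ℂ → Cn n := fun t => φ (t • ζ) with hg
  have hmem : ∀ t ∈ ball (0 : ℂ) 1, t • ζ ∈ unitBall n := by
    intro t ht
    rw [mem_ball_zero_iff] at ht ⊢
    rwa [norm_smul, hζ, mul_one]
  have hg0 : g 0 = 0 := by simp [hg, hφ0]
  have hd : DifferentiableOn ℂ g (ball 0 1) :=
    hφ.analytic.differentiableOn.comp (by fun_prop) hmem
  have hm : Set.MapsTo g (ball 0 1) (closedBall (g 0) 1) := by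
    intro t ht
    rw [hg0]
    exact ball_subset_closedBall (hφ.mapsTo (hmem t ht))
  have heq := Complex.affine_of_mapsTo_ball_of_norm_dslope_eq_div hd hm
    (mem_ball_zero_iff.mpr ht₀) (by rw [h, div_one])
  refine ⟨ζ, dslope g 0 t₀, hζ, h, fun t ht => ?_⟩
  have := heq (mem_ball_zero_iff.mpr ht)
  simpa [hg0] using this

/-- Equality would make the difference quotient along the slice through `z` have norm one at `t =
‖z‖`, the extremal case of the Schwarz lemma. -/
theorem IsAnalyticSelfMap.norm_apply_lt {n : ℕ} {φ : Cn n → Cn n}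
    (hφ : IsAnalyticSelfMap φ) (hφ0 : φ 0 = 0) (hslice : ¬ IsUnitaryOnSomeSlice φ) {z : Cn n}
    (hz : z ∈ unitBall n) (hz0 : z ≠ 0) : ‖φ z‖ < ‖z‖ := by
  have hz1 : ‖z‖ < 1 := mem_ball_zero_iff.mp hz
  have hle : ‖φ z‖ ≤ ‖z‖ :=
    Complex.norm_le_norm_of_mapsTo_ball hφ.analytic.differentiableOn
      (hφ.mapsTo.mono_right ball_subset_closedBall) hφ0 hz1
  refine lt_of_le_of_ne hle fun heq => hslice ?_
  have hzn : ‖z‖ ≠ 0 := norm_ne_zero_iff.mpr hz0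
  have hzc : (‖z‖ : ℂ) ≠ 0 := Complex.ofReal_ne_zero.mpr hzn
  refine hφ.isUnitaryOnSomeSlice_of_norm_dslope_eq_one hφ0 (ζ := (‖z‖ : ℂ)⁻¹ • z)
    (t₀ := (‖z‖ : ℂ)) (by simp [norm_smul, hzn]) (by simpa using hz1) ?_
  rw [dslope_of_ne _ hzc, slope_def_module, smul_smul, mul_inv_cancel₀ hzc, one_smul, zero_smul,
    hφ0, sub_zero, sub_zero, norm_smul, heq]
  simp [hzn]

/-- The extremal case at `t = 0` excludes equality in each direction, and compactness of the sphere
makes the bound uniform. -/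
theorem IsAnalyticSelfMap.norm_fderiv_lt_one {n : ℕ} {φ : Cn n → Cn n}
    (hφ : IsAnalyticSelfMap φ) (hφ0 : φ 0 = 0) (hslice : ¬ IsUnitaryOnSomeSlice φ) :
    ‖fderiv ℂ φ 0‖ < 1 := by
  have hdiff : DifferentiableAt ℂ φ 0 := (hφ.analytic 0 (by simp)).differentiableAt
  have hlt : ∀ ζ : Cn n, ‖ζ‖ = 1 → ‖fderiv ℂ φ 0 ζ‖ < 1 := by
    intro ζ hζ
    have hle : ‖fderiv ℂ φ 0 ζ‖ ≤ 1 := by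
      simpa [hζ] using (fderiv ℂ φ 0).le_of_opNorm_le (hφ.norm_fderiv_le_one hφ0) ζ
    refine lt_of_le_of_ne hle fun heq => hslice ?_
    refine hφ.isUnitaryOnSomeSlice_of_norm_dslope_eq_one hφ0 hζ (t₀ := 0) (by simp) ?_
    rw [dslope_same]
    have hd : HasDerivAt (fun t : ℂ => t • ζ) ζ 0 := by
      simpa using (hasDerivAt_id (0 : ℂ)).smul_const ζ
    have h0 : HasFDerivAt φ (fderiv ℂ φ 0) ((0 : ℂ) • ζ) := by
      rw [zero_smul]; exact hdiff.hasFDerivAt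
    rw [show deriv (fun t : ℂ => φ (t • ζ)) 0 = fderiv ℂ φ 0 ζ from
      (h0.comp_hasDerivAt (0 : ℂ) hd).deriv, heq]
  -- The sphere is empty exactly when `n = 0`.
  rcases (sphere (0 : Cn n) 1).eq_empty_or_nonempty with he | hne
  · have : ‖fderiv ℂ φ 0‖ ≤ 0 := by
      refine ContinuousLinearMap.opNorm_le_bound _ le_rfl fun v => ?_
      by_cases hv : v = 0
      · simp [hv]
      · have : ((‖v‖ : ℂ)⁻¹ • v) ∈ sphere (0 : Cn n) 1 := by
          simp [norm_smul, hv]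
        rw [he] at this
        exact this.elim
    linarith
  · obtain ⟨ζ, hζ, hmax⟩ := (isCompact_sphere (0 : Cn n) 1).exists_isMaxOn hne
      (f := fun ζ => ‖fderiv ℂ φ 0 ζ‖) (by fun_prop)
    refine lt_of_le_of_lt ?_ (hlt ζ (by simpa using hζ))
    refine ContinuousLinearMap.opNorm_le_bound _ (norm_nonneg _) fun v => ?_
    by_cases hv : v = 0
    · simp [hv]
    · have hmem : ((‖v‖ : ℂ)⁻¹ • v) ∈ sphere (0 : Cn n) 1 := by
        simp [norm_smul, hv]
      have h := hmax hmem
      have hv' : 0 < ‖v‖ := norm_pos_iff.mpr hv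
      simp only [Set.mem_ofPred_eq, map_smul, norm_smul, norm_inv, Complex.norm_real,
        norm_norm] at h
      rwa [inv_mul_le_iff₀ hv', mul_comm] at h

/-! ### Decay of iterates and correction of approximate solutions -/

/-- Geometric decay of the iterates of a self-map of the unit ball that strictly decreases the
norm, at every rate above the norm of its derivative at the fixed point `0`. -/
theorem exists_norm_iterate_le {E : Type*} [NormedAddCommGroup E] [NormedSpace ℂ E]
    [ProperSpace E] {φ : E → E} (hc : ContinuousOn φ (ball 0 1)) (hφ0 : φ 0 = 0)
    (hlt : ∀ z ∈ ball (0 : E) 1, z ≠ 0 → ‖φ z‖ < ‖z‖) {A : E →L[ℂ] E} (hA : HasFDerivAt φ A 0)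
    {q : ℝ} (hAq : ‖A‖ < q) (hq1 : q < 1) {ρ : ℝ} (hρ : ρ < 1) :
    ∃ K : ℝ, 0 ≤ K ∧ ∀ z ∈ closedBall (0 : E) ρ, ∀ j, ‖φ^[j] z‖ ≤ K * q ^ j * ‖z‖ := by
  have hq0 : 0 < q := (norm_nonneg _).trans_lt hAq
  obtain ⟨δ, hδ, hδφ⟩ : ∃ δ > 0, ∀ z ∈ ball (0 : E) δ, ‖φ z‖ ≤ q * ‖z‖ := by
    have h := hA.isLittleO.def (sub_pos.mpr hAq)
    obtain ⟨δ, hδ, h⟩ := Metric.eventually_nhds_iff_ball.mp h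
    refine ⟨δ, hδ, fun z hz => ?_⟩
    have h1 := h z hz
    rw [hφ0, sub_zero, sub_zero] at h1
    have h2 := norm_le_insert' (φ z) (A z)
    have h3 := A.le_opNorm z
    linarith
  have hsub : closedBall (0 : E) ρ ⊆ ball 0 1 := closedBall_subset_ball hρ
  -- Near `0` the rate is `q` by differentiability; on the remaining compact shell strict decrease
  -- gives some rate `c < 1`.
  obtain ⟨c, hc1, hcφ⟩ : ∃ c < 1, ∀ z ∈ closedBall (0 : E) ρ \ ball 0 δ, ‖φ z‖ ≤ c * ‖z‖ := by
    have hne0 : ∀ z ∈ closedBall (0 : E) ρ \ ball 0 δ, z ≠ 0 := by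
      rintro z hz rfl
      exact hz.2 (mem_ball_self hδ)
    rcases (closedBall (0 : E) ρ \ ball 0 δ).eq_empty_or_nonempty with he | hne
    · exact ⟨0, one_pos, by simp [he]⟩
    · obtain ⟨x, hx, hmax⟩ := ((isCompact_closedBall (0 : E) ρ).diff isOpen_ball).exists_isMaxOn
        hne (f := fun z => ‖φ z‖ / ‖z‖) (by
          refine ContinuousOn.div ?_ continuous_norm.continuousOn
            fun z hz => norm_ne_zero_iff.mpr (hne0 z hz)
          exact (hc.mono (Set.sdiff_subset.trans hsub)).norm)
      refine ⟨‖φ x‖ / ‖x‖, ?_, fun z hz => ?_⟩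
      · rw [div_lt_one (norm_pos_iff.mpr (hne0 x hx))]
        exact hlt x (hsub hx.1) (hne0 x hx)
      · exact (div_le_iff₀ (norm_pos_iff.mpr (hne0 z hz))).mp (hmax hz)
  set b := max c q with hb
  have hb0 : 0 < b := lt_max_of_lt_right hq0
  have hb1 : b < 1 := max_lt hc1 hq1
  have hbφ : ∀ z ∈ closedBall (0 : E) ρ, ‖φ z‖ ≤ b * ‖z‖ := by
    intro z hz
    by_cases hzδ : z ∈ ball (0 : E) δ
    · exact (hδφ z hzδ).trans (by gcongr; exact le_max_right _ _)
    · exact (hcφ z ⟨hz, hzδ⟩).trans (by gcongr; exact le_max_left _ _)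
  have hbj : ∀ z ∈ closedBall (0 : E) ρ, ∀ j, ‖φ^[j] z‖ ≤ b ^ j * ‖z‖ := by
    intro z hz j
    induction j with
    | zero => simp
    | succ j ih =>
      rw [Function.iterate_succ_apply']
      have hmem : φ^[j] z ∈ closedBall (0 : E) ρ := by
        rw [mem_closedBall_zero_iff] at hz ⊢
        exact (ih.trans (mul_le_of_le_one_left (norm_nonneg _)
          (pow_le_one₀ hb0.le hb1.le))).trans hz
      calc ‖φ (φ^[j] z)‖ ≤ b * ‖φ^[j] z‖ := hbφ _ hmem
        _ ≤ b * (b ^ j * ‖z‖) := by gcongr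
        _ = b ^ (j + 1) * ‖z‖ := by ring
  obtain ⟨j₀, hj₀⟩ := exists_pow_lt_of_lt_one hδ hb1
  -- After `j₀` steps the orbit stays in the `δ`-ball, where the rate is `q`; the constant `q^(-j₀)`
  -- pays for the earlier steps.
  refine ⟨(1 / q) ^ j₀, by positivity, fun z hz j => ?_⟩
  have hz1 : ‖z‖ ≤ 1 := (mem_closedBall_zero_iff.mp hz).trans hρ.le
  have hsmall : ∀ j ≤ j₀, ‖φ^[j] z‖ ≤ (1 / q) ^ j₀ * q ^ j * ‖z‖ := by
    intro j hj
    refine (hbj z hz j).trans ?_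
    gcongr
    refine (pow_le_one₀ hb0.le hb1.le).trans ?_
    rw [one_div, inv_pow, ← div_eq_inv_mul, one_le_div (by positivity)]
    exact pow_le_pow_of_le_one hq0.le hq1.le hj
  induction j with
  | zero => exact hsmall 0 (Nat.zero_le _)
  | succ j ih =>
    by_cases hj : j + 1 ≤ j₀
    · exact hsmall _ hj
    · rw [Function.iterate_succ_apply']
      have hmem : φ^[j] z ∈ ball (0 : E) δ := by
        rw [mem_ball_zero_iff]
        refine ((hbj z hz j).trans (mul_le_of_le_one_right (by positivity) hz1)).trans_lt ?_
        exact (pow_le_pow_of_le_one hb0.le hb1.le (by omega)).trans_lt hj₀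
      calc ‖φ (φ^[j] z)‖ ≤ q * ‖φ^[j] z‖ := hδφ _ hmem
        _ ≤ q * ((1 / q) ^ j₀ * q ^ j * ‖z‖) := by gcongr
        _ = (1 / q) ^ j₀ * q ^ (j + 1) * ‖z‖ := by ring

theorem exists_norm_le_mul_pow_of_isBigO {E G : Type*} [NormedAddCommGroup E] [NormedSpace ℂ E]
    [ProperSpace E] [NormedAddCommGroup G] {R : E → G} {N : ℕ}
    (hc : ContinuousOn R (ball 0 1)) (hR : R =O[𝓝 0] fun z => ‖z‖ ^ N) {ρ : ℝ} (hρ : ρ < 1) :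
    ∃ C : ℝ, 0 ≤ C ∧ ∀ z ∈ closedBall (0 : E) ρ, ‖R z‖ ≤ C * ‖z‖ ^ N := by
  obtain ⟨C₁, hC₁, h1⟩ := hR.exists_pos
  obtain ⟨δ, hδ, h1⟩ := Metric.eventually_nhds_iff_ball.mp h1.bound
  obtain ⟨C₂, h2⟩ := (isCompact_closedBall (0 : E) ρ).exists_bound_of_continuousOn
    (hc.mono (closedBall_subset_ball hρ))
  refine ⟨max C₁ (C₂ / δ ^ N), hC₁.le.trans (le_max_left _ _), fun z hz => ?_⟩
  by_cases hzδ : z ∈ ball (0 : E) δ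
  · have := h1 z hzδ
    rw [Real.norm_of_nonneg (by positivity)] at this
    exact this.trans (by gcongr; exact le_max_left _ _)
  · rw [mem_ball_zero_iff, not_lt] at hzδ
    have hC₂ : 0 ≤ C₂ := (norm_nonneg _).trans (h2 z hz)
    calc ‖R z‖ ≤ C₂ := h2 z hz
      _ = C₂ / δ ^ N * δ ^ N := by field_simp
      _ ≤ max C₁ (C₂ / δ ^ N) * ‖z‖ ^ N := by
        gcongr
        exact le_max_right _ _

/-- An analytic approximate solution of `F ∘ φ = P ∘ F`, with an error that vanishes to high order
at the fixed point `0`, can be corrected to a solution without changing its low order jet. -/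
theorem exists_solution_of_approximate_solution {E G : Type*} [NormedAddCommGroup E]
    [NormedSpace ℂ E] [ProperSpace E] [NormedAddCommGroup G] [NormedSpace ℂ G] [CompleteSpace G]
    {φ : E → E} (hφ : AnalyticOnNhd ℂ φ (ball 0 1)) (hφ0 : φ 0 = 0)
    (hlt : ∀ z ∈ ball (0 : E) 1, z ≠ 0 → ‖φ z‖ < ‖z‖)
    {q : ℝ} (hq : ‖fderiv ℂ φ 0‖ < q) (hq1 : q < 1)
    (P P' : G →L[ℂ] G) (hP : ∀ v, P (P' v) = v) {N : ℕ} (hN : ‖P'‖ * q ^ N < 1)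
    {F₀ : E → G} (hF₀ : AnalyticOnNhd ℂ F₀ (ball 0 1))
    (hR : (fun z => F₀ (φ z) - P (F₀ z)) =O[𝓝 0] fun z => ‖z‖ ^ N) :
    ∃ F : E → G, AnalyticOnNhd ℂ F (ball 0 1) ∧ (∀ z ∈ ball (0 : E) 1, F (φ z) = P (F z)) ∧
      (fun z => F z - F₀ z) =O[𝓝 0] fun z => ‖z‖ ^ N := by
  have hq0 : 0 < q := (norm_nonneg _).trans_lt hq
  have hle : ∀ z ∈ ball (0 : E) 1, ‖φ z‖ ≤ ‖z‖ := by
    intro z hz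
    by_cases h : z = 0
    · simp [h, hφ0]
    · exact (hlt z hz h).le
  have hmaps : ∀ ρ ≤ (1 : ℝ), Set.MapsTo φ (ball 0 ρ) (ball 0 ρ) := by
    intro ρ hρ z hz
    have := hle z (ball_subset_ball hρ hz)
    rw [mem_ball_zero_iff] at hz ⊢
    exact this.trans_lt hz
  have hiter : ∀ ρ ≤ (1 : ℝ), ∀ j, Set.MapsTo φ^[j] (ball 0 ρ) (ball 0 ρ) := fun ρ hρ j =>
    (hmaps ρ hρ).iterate j
  have hiterA : ∀ j, AnalyticOnNhd ℂ φ^[j] (ball 0 1) := by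
    intro j
    induction j with
    | zero => exact analyticOnNhd_id
    | succ j ih =>
      rw [Function.iterate_succ']
      exact hφ.comp ih (hiter 1 le_rfl j)
  set R : E → G := fun z => F₀ (φ z) - P (F₀ z) with hRdef
  have hRA : AnalyticOnNhd ℂ R (ball 0 1) :=
    (hF₀.comp hφ (hmaps 1 le_rfl)).sub (P.comp_analyticOnNhd hF₀)
  -- The terms telescope: `P (f 0 z) = R z` and `P (f (j + 1) z) = f j (φ z)`.
  set f : ℕ → E → G := fun j z => (P' ^ (j + 1)) (R (φ^[j] z)) with hf
  have hfA : ∀ j, AnalyticOnNhd ℂ (f j) (ball 0 1) := fun j =>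
    (P' ^ (j + 1)).comp_analyticOnNhd (hRA.comp (hiterA j) (hiter 1 le_rfl j))
  set a : ℝ := ‖P'‖ * q ^ N with ha
  have ha0 : 0 ≤ a := by positivity
  have hbound : ∀ ρ < (1 : ℝ), ∃ C : ℝ, 0 ≤ C ∧
      ∀ z ∈ ball (0 : E) ρ, ∀ j, ‖f j z‖ ≤ C * ‖z‖ ^ N * a ^ j := by
    intro ρ hρ
    obtain ⟨C, hC, h1⟩ := exists_norm_le_mul_pow_of_isBigO hRA.continuousOn hR hρ
    obtain ⟨K, hK, h2⟩ := exists_norm_iterate_le hφ.continuousOn hφ0 hlt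
      (hφ 0 (mem_ball_self one_pos)).differentiableAt.hasFDerivAt hq hq1 hρ
    refine ⟨‖P'‖ * C * K ^ N, by positivity, fun z hz j => ?_⟩
    calc ‖f j z‖ ≤ ‖P' ^ (j + 1)‖ * ‖R (φ^[j] z)‖ := ContinuousLinearMap.le_opNorm _ _
      _ ≤ ‖P'‖ ^ (j + 1) * (C * (K * q ^ j * ‖z‖) ^ N) := by
        gcongr
        · exact norm_pow_le' _ (Nat.succ_pos j)
        · refine (h1 _ (ball_subset_closedBall (hiter ρ hρ.le j hz))).trans ?_
          gcongr
          exact h2 z (ball_subset_closedBall hz) j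
      _ = ‖P'‖ * C * K ^ N * ‖z‖ ^ N * a ^ j := by
        rw [ha]
        ring
  have hgeom : Summable fun j => a ^ j := summable_geometric_of_lt_one ha0 hN
  have hsum : ∀ z ∈ ball (0 : E) 1, Summable fun j => f j z := by
    intro z hz
    obtain ⟨ρ, hρz, hρ⟩ := exists_between (mem_ball_zero_iff.mp hz)
    obtain ⟨C, -, hC⟩ := hbound ρ hρ
    exact Summable.of_norm_bounded (hgeom.mul_left _) (hC z (mem_ball_zero_iff.mpr hρz))
  refine ⟨fun z => F₀ z + ∑' j, f j z, ?_, ?_, ?_⟩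
  · refine hF₀.add fun c hc => ?_
    obtain ⟨ρ, hρc, hρ⟩ := exists_between (mem_ball_zero_iff.mp hc)
    obtain ⟨C, hC0, hC⟩ := hbound ρ hρ
    have hsub : ball c (ρ - ‖c‖) ⊆ ball 0 ρ := ball_subset_ball' (by simp)
    refine analyticAt_tsum_of_summable_norm_le (sub_pos.mpr hρc) (hgeom.mul_left C)
      (fun j => (hfA j).mono (hsub.trans (ball_subset_ball hρ.le))) fun j z hz => ?_
    refine (hC z (hsub hz) j).trans ?_
    gcongr
    refine mul_le_of_le_one_right hC0 (pow_le_one₀ (norm_nonneg _) ?_)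
    exact (mem_ball_zero_iff.mp (hsub hz)).le.trans hρ.le
  · intro z hz
    have hshift : ∀ j, P (f (j + 1) z) = f j (φ z) := by
      intro j
      simp only [hf]
      rw [pow_succ', mul_apply_eq_comp, hP, Function.iterate_succ_apply]
    have hzero : P (f 0 z) = R z := by simp [hf, hP]
    rw [map_add, P.map_tsum (hsum z hz),
      ((P.summable (hsum z hz)).tsum_eq_zero_add :), hzero, hRdef]
    simp_rw [hshift]
    abel
  · obtain ⟨C, -, hC⟩ := hbound (1 / 2) (by norm_num)
    refine Asymptotics.IsBigO.of_bound (C * (1 - a)⁻¹) ?_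
    filter_upwards [ball_mem_nhds (0 : E) (by norm_num : (0 : ℝ) < 1 / 2)] with z hz
    rw [add_sub_cancel_left, Real.norm_of_nonneg (by positivity)]
    refine (tsum_of_norm_bounded ((hasSum_geometric_of_lt_one ha0 hN).mul_left _)
      (hC z hz)).trans (le_of_eq (by ring))

/-! ### Order of vanishing and the leading part of `C_φ` -/

theorem isBigO_norm_pow_of_iteratedFDeriv_eq_zero {E G : Type*} [NormedAddCommGroup E]
    [NormedSpace ℂ E] [NormedAddCommGroup G] [NormedSpace ℂ G] [CompleteSpace G] {f : E → G}
    (hf : AnalyticAt ℂ f 0) {N : ℕ} (h : ∀ m < N, iteratedFDeriv ℂ m f 0 = 0) :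
    f =O[𝓝 0] fun z => ‖z‖ ^ N := by
  obtain ⟨p, r, hp⟩ := hf
  have h1 := (HasFPowerSeriesOnBall.hasFPowerSeriesAt hp).isBigO_sub_partialSum_pow N
  refine h1.congr_left fun y => ?_
  rw [zero_add, sub_eq_self, FormalMultilinearSeries.partialSum]
  refine Finset.sum_eq_zero fun m hm => ?_
  have h2 := hp.factorial_smul y m
  rw [h m (Finset.mem_range.mp hm), zero_apply, ← Nat.cast_smul_eq_nsmul ℂ, smul_eq_zero] at h2
  exact h2.resolve_left (Nat.cast_ne_zero.mpr (Nat.factorial_ne_zero m))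

theorem AnalyticAt.isBigO_sub_fderiv {E G : Type*} [NormedAddCommGroup E]
    [NormedSpace ℂ E] [NormedAddCommGroup G] [NormedSpace ℂ G] [CompleteSpace G] {f : E → G}
    (hf : AnalyticAt ℂ f 0) (hf0 : f 0 = 0) :
    (fun z => f z - fderiv ℂ f 0 z) =O[𝓝 0] fun z => ‖z‖ ^ 2 := by
  refine isBigO_norm_pow_of_iteratedFDeriv_eq_zero
    (hf.sub ((fderiv ℂ f 0).analyticAt 0)) fun m hm => ?_
  interval_cases m
  · ext; simp [hf0]
  · rw [← norm_eq_zero, norm_iteratedFDeriv_one, norm_eq_zero,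
      fderiv_sub hf.differentiableAt (fderiv ℂ f 0).differentiableAt,
      ContinuousLinearMap.fderiv, sub_self]

/-- Scalar functions analytic on the unit ball that vanish to order `d` at `0`. -/
def vanishingSubmodule (E : Type*) [NormedAddCommGroup E] [NormedSpace ℂ E] (d : ℕ) :
    Submodule ℂ (E → ℂ) where
  carrier := {f | AnalyticOnNhd ℂ f (ball 0 1) ∧ f =O[𝓝 0] fun z => ‖z‖ ^ d}
  add_mem' hf hg := ⟨hf.1.add hg.1, hf.2.add hg.2⟩
  zero_mem' := ⟨analyticOnNhd_const, Asymptotics.isBigO_zero _ _⟩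
  smul_mem' c _ hf := ⟨hf.1.const_smul, hf.2.const_smul_left c⟩

theorem isBigO_norm_pow_of_le {E : Type*} [NormedAddCommGroup E] {d d' : ℕ} (h : d ≤ d') :
    (fun z : E => ‖z‖ ^ d') =O[𝓝 0] fun z => ‖z‖ ^ d := by
  refine Asymptotics.IsBigO.of_bound 1 ?_
  filter_upwards [ball_mem_nhds (0 : E) one_pos] with z hz
  rw [norm_pow, norm_pow, norm_norm, one_mul]
  exact pow_le_pow_of_le_one (norm_nonneg _) (mem_ball_zero_iff.mp hz).le h

theorem vanishingSubmodule_anti {E : Type*} [NormedAddCommGroup E] [NormedSpace ℂ E] {d d' : ℕ}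
    (h : d ≤ d') : vanishingSubmodule E d' ≤ vanishingSubmodule E d := fun _ hf =>
  ⟨hf.1, hf.2.trans (isBigO_norm_pow_of_le h)⟩

theorem comp_mem_vanishingSubmodule {E : Type*} [NormedAddCommGroup E] [NormedSpace ℂ E]
    {φ : E → E} (hφ : AnalyticOnNhd ℂ φ (ball 0 1)) (hmaps : Set.MapsTo φ (ball 0 1) (ball 0 1))
    (hφ0 : φ 0 = 0) {d : ℕ} {f : E → ℂ} (hf : f ∈ vanishingSubmodule E d) :
    LinearMap.funLeft ℂ ℂ φ f ∈ vanishingSubmodule E d := by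
  have hd : DifferentiableAt ℂ φ 0 := (hφ 0 (mem_ball_self one_pos)).differentiableAt
  have hO : φ =O[𝓝 0] fun z : E => ‖z‖ := by
    have := hd.isBigO_sub
    simp only [hφ0, sub_zero] at this
    exact this.norm_right
  have ht : Filter.Tendsto φ (𝓝 0) (𝓝 0) := by
    have := hd.continuousAt.tendsto
    rwa [hφ0] at this
  refine ⟨hf.1.comp hφ hmaps, (hf.2.comp_tendsto ht).trans ?_⟩
  exact hO.norm_left.pow d

/-- The derivatives at `0` of order below `N` lie in a finite-dimensional space, and a function on
which they all vanish has order `N`. -/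
theorem finiteDimensional_quotient_vanishingSubmodule {E : Type*} [NormedAddCommGroup E]
    [NormedSpace ℂ E] [FiniteDimensional ℂ E] (d N : ℕ) :
    FiniteDimensional ℂ (vanishingSubmodule E d ⧸
      (vanishingSubmodule E N).submoduleOf (vanishingSubmodule E d)) := by
  have hcd : ∀ (m : ℕ) (f : vanishingSubmodule E d), ContDiffAt ℂ m (f : E → ℂ) 0 := fun m f =>
    (f.2.1 0 (mem_ball_self one_pos)).contDiffAt
  let J : vanishingSubmodule E d →ₗ[ℂ]
      ((m : Fin N) → MultilinearMap ℂ (fun _ : Fin m => E) ℂ) :=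
    { toFun := fun f m => (iteratedFDeriv ℂ m (f : E → ℂ) 0).toMultilinearMap
      map_add' := fun f g => by
        funext m
        rw [Submodule.coe_add, iteratedFDeriv_add_apply (hcd m f) (hcd m g)]
        rfl
      map_smul' := fun c f => by
        funext m
        rw [Submodule.coe_smul, iteratedFDeriv_const_smul_apply (hcd m f)]
        rfl }
  have hker : LinearMap.ker J ≤
      (vanishingSubmodule E N).submoduleOf (vanishingSubmodule E d) := by
    intro f hf
    refine ⟨f.2.1, isBigO_norm_pow_of_iteratedFDeriv_eq_zero (f.2.1 0 (mem_ball_self one_pos))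
      fun m hm => ?_⟩
    have := congrFun (LinearMap.mem_ker.mp hf) ⟨m, hm⟩
    exact ContinuousMultilinearMap.toMultilinearMap_injective this
  have : FiniteDimensional ℂ (vanishingSubmodule E d ⧸ LinearMap.ker J) :=
    Module.Finite.equiv J.quotKerEquivRange.symm
  exact Module.Finite.of_surjective _ (Submodule.factor_surjective hker)

theorem isBigO_mul_sub_mul {E : Type*} [NormedAddCommGroup E] {f g f' g' : E → ℂ} {p q : ℕ}
    (hf : f =O[𝓝 0] fun z => ‖z‖ ^ p) (hg' : g' =O[𝓝 0] fun z => ‖z‖ ^ q)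
    (h : (fun z => f z - g z) =O[𝓝 0] fun z => ‖z‖ ^ (p + 1))
    (h' : (fun z => f' z - g' z) =O[𝓝 0] fun z => ‖z‖ ^ (q + 1)) :
    (fun z => f z * f' z - g z * g' z) =O[𝓝 0] fun z => ‖z‖ ^ (p + q + 1) := by
  have h1 : (fun z => f z * (f' z - g' z)) =O[𝓝 0] fun z => ‖z‖ ^ (p + q + 1) :=
    (hf.mul h').congr_right fun z => by ring
  have h2 : (fun z => (f z - g z) * g' z) =O[𝓝 0] fun z => ‖z‖ ^ (p + q + 1) :=
    (h.mul hg').congr_right fun z => by ring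
  exact (h1.add h2).congr_left fun z => by ring

theorem Module.Dual.isBigO_norm {E : Type*} [NormedAddCommGroup E] [NormedSpace ℂ E]
    [FiniteDimensional ℂ E] (w : Module.Dual ℂ E) : (fun z => w z) =O[𝓝 0] fun z => ‖z‖ ^ 1 := by
  simpa using (LinearMap.toContinuousLinearMap w).isBigO_id (𝓝 0) |>.norm_right

theorem Module.Dual.analyticOnNhd {E : Type*} [NormedAddCommGroup E] [NormedSpace ℂ E]
    [FiniteDimensional ℂ E] (w : Module.Dual ℂ E) (s : Set E) :
    AnalyticOnNhd ℂ (fun z => w z) s :=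
  (LinearMap.toContinuousLinearMap w).analyticOnNhd s

/-- The homogeneous polynomial `eᵈ u` of degree `d + 1`, for linear functionals `e` and `u`. -/
def dualMonomial {E : Type*} [NormedAddCommGroup E] [NormedSpace ℂ E] [FiniteDimensional ℂ E]
    (d : ℕ) (e : Module.Dual ℂ E) : Module.Dual ℂ E →ₗ[ℂ] vanishingSubmodule E (d + 1) where
  toFun u := ⟨fun z => e z ^ d * u z, ((e.analyticOnNhd _).pow d).mul (u.analyticOnNhd _), by
    have h : (fun z => e z ^ d) =O[𝓝 0] fun z => ‖z‖ ^ d := by simpa using e.isBigO_norm.pow d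
    exact (h.mul u.isBigO_norm).congr_right fun z => by ring⟩
  map_add' u v := by
    ext z
    exact mul_add _ _ _
  map_smul' c u := by
    ext z
    exact mul_left_comm _ _ _

/-- To leading order `φ` may be replaced by its derivative, which multiplies the eigenfunctional `e`
by `l` and transposes onto `u`. -/
theorem comp_dualMonomial_sub_mem {E : Type*} [NormedAddCommGroup E] [NormedSpace ℂ E]
    [FiniteDimensional ℂ E] {φ : E → E} (hφ : AnalyticOnNhd ℂ φ (ball 0 1))
    (hmaps : Set.MapsTo φ (ball 0 1) (ball 0 1)) (hφ0 : φ 0 = 0) (d : ℕ) {e : Module.Dual ℂ E}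
    {l : ℂ} (he : ∀ v, e (fderiv ℂ φ 0 v) = l * e v) (u : Module.Dual ℂ E) :
    LinearMap.funLeft ℂ ℂ φ (dualMonomial d e u : E → ℂ) -
      l ^ d • (dualMonomial d e (u ∘ₗ (fderiv ℂ φ 0 : E →ₗ[ℂ] E)) : E → ℂ) ∈
      vanishingSubmodule E (d + 2) := by
  refine ⟨(comp_mem_vanishingSubmodule hφ hmaps hφ0 (dualMonomial d e u).2).1.sub
    ((dualMonomial d e _).2.1.const_smul), ?_⟩
  have hφA := (hφ 0 (mem_ball_self one_pos)).isBigO_sub_fderiv hφ0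
  have hw : ∀ w : Module.Dual ℂ E,
      (fun z => w (φ z) - w (fderiv ℂ φ 0 z)) =O[𝓝 0] fun z => ‖z‖ ^ 2 := fun w => by
    refine (((LinearMap.toContinuousLinearMap w).isBigO_comp _ (𝓝 0)).trans hφA).congr_left
      fun z => ?_
    simp
  have hO : ∀ w : Module.Dual ℂ E, (fun z => w (φ z)) =O[𝓝 0] fun z => ‖z‖ ^ 1 := fun w => by
    have h1 := (hw w).trans (isBigO_norm_pow_of_le one_le_two)
    have h2 := Module.Dual.isBigO_norm (w ∘ₗ (fderiv ℂ φ 0 : E →ₗ[ℂ] E))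
    exact (h1.add h2).congr_left fun z => by simp
  have hp : ∀ j, (fun z => e (φ z) ^ j) =O[𝓝 0] fun z => ‖z‖ ^ j := fun j => by
    simpa using (hO e).pow j
  have hpow : ∀ j, (fun z => e (φ z) ^ j - (l * e z) ^ j) =O[𝓝 0] fun z => ‖z‖ ^ (j + 1) := by
    intro j
    induction j with
    | zero => simpa using Asymptotics.isBigO_zero _ _
    | succ j ih =>
      simp only [pow_succ _ j]
      refine isBigO_mul_sub_mul (hp j) (e.isBigO_norm.const_mul_left l) ih ?_
      simpa only [he] using hw e
  have := isBigO_mul_sub_mul (hp d) 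
    (Module.Dual.isBigO_norm (u ∘ₗ (fderiv ℂ φ 0 : E →ₗ[ℂ] E))) (hpow d)
    (by simpa using hw u)
  refine this.congr_left fun z => ?_
  simp [dualMonomial, LinearMap.funLeft_apply, mul_pow, mul_assoc]

/-- Divide by `tᵏ` along the line through `v` and let `t` tend to `0`. -/
theorem eq_zero_of_isBigO_norm_pow_succ {E : Type*} [NormedAddCommGroup E] [NormedSpace ℂ E]
    {f : E → ℂ} {k : ℕ} (hf : f =O[𝓝 0] fun z => ‖z‖ ^ (k + 1)) {v : E} {c : ℂ}
    (hc : ∀ t : ℂ, f (t • v) = c * t ^ k) : c = 0 := by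
  have ht : Filter.Tendsto (fun t : ℂ => t • v) (𝓝 0) (𝓝 0) := by
    have : Continuous fun t : ℂ => t • v := by fun_prop
    simpa using this.tendsto 0
  obtain ⟨C, hC⟩ := (hf.comp_tendsto ht).bound
  have h1 : ∀ᶠ t : ℂ in 𝓝[≠] 0, ‖c‖ ≤ C * ‖v‖ ^ (k + 1) * ‖t‖ := by
    filter_upwards [hC.filter_mono nhdsWithin_le_nhds, self_mem_nhdsWithin] with t h1 h2
    have ht0 : 0 < ‖t‖ := norm_pos_iff.mpr h2
    simp only [Function.comp_apply, hc, norm_mul, norm_pow, norm_smul, norm_norm] at h1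
    have : ‖c‖ * ‖t‖ ^ k ≤ C * ‖v‖ ^ (k + 1) * ‖t‖ * ‖t‖ ^ k := by
      refine h1.trans (le_of_eq ?_)
      ring
    exact le_of_mul_le_mul_right this (by positivity)
  have h2 : Filter.Tendsto (fun t : ℂ => C * ‖v‖ ^ (k + 1) * ‖t‖) (𝓝[≠] 0) (𝓝 0) := by
    have : Continuous fun t : ℂ => C * ‖v‖ ^ (k + 1) * ‖t‖ := by fun_prop
    simpa using (this.tendsto 0).mono_left nhdsWithin_le_nhds
  exact norm_le_zero_iff.mp (ge_of_tendsto h2 h1)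

/-- Powers of independent linear functionals are independent modulo functions of higher order. -/
theorem eq_zero_of_sum_pow_mem_vanishingSubmodule {E ι : Type*} [NormedAddCommGroup E]
    [NormedSpace ℂ E] [FiniteDimensional ℂ E] [Fintype ι] {e : ι → Module.Dual ℂ E}
    (he : LinearIndependent ℂ e) (k : ℕ) (hk : k ≠ 0) (c : ι → ℂ)
    (h : (fun z => ∑ i, c i * e i z ^ k) ∈ vanishingSubmodule E (k + 1)) (j : ι) : c j = 0 := by
  classical
  -- By reflexivity a dual vector `v` satisfies `e i v = δᵢⱼ`; along its line only `c j * tᵏ`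
  -- remains, as `0ᵏ = 0` for `k ≠ 0`.
  obtain ⟨g, hg⟩ := LinearMap.exists_extend ((Finsupp.lapply j : (ι →₀ ℂ) →ₗ[ℂ] ℂ) ∘ₗ
    (he.repr : _ →ₗ[ℂ] (ι →₀ ℂ)))
  have hge : ∀ i, g (e i) = if i = j then 1 else 0 := by
    intro i
    have hmem : e i ∈ Submodule.span ℂ (Set.range e) := Submodule.subset_span ⟨i, rfl⟩
    have h1 := LinearMap.congr_fun hg ⟨e i, hmem⟩
    simp only [LinearMap.comp_apply, Submodule.subtype_apply] at h1
    rw [h1, he.repr_eq_single i _ rfl, Finsupp.lapply_apply, Finsupp.single_apply]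
  obtain ⟨v, hv⟩ := (Module.evalEquiv ℂ E).surjective g
  have hev : ∀ i, e i v = if i = j then 1 else 0 := by
    intro i
    rw [← hge i, ← hv]
    rfl
  refine eq_zero_of_isBigO_norm_pow_succ h.2 (v := v) fun t => ?_
  simp only [map_smul, hev, smul_eq_mul, mul_ite, mul_one, mul_zero]
  rw [Finset.sum_eq_single j] <;> simp +contextual [hk]

-- Modulo `L`, `T - c l` acts on the image of `g` as `c (S - l)`, and invariance of `L` allows
-- iteration. This turns chains of `S` into chains of monomials.
open Module in
theorem sub_smul_one_pow_apply_sub_mem {K X W : Type*} [Field K] [AddCommGroup X] [Module K X]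
    [AddCommGroup W] [Module K W] (T : End K X) (L : Submodule K X) (hT : ∀ x ∈ L, T x ∈ L)
    (S : End K W) (g : W →ₗ[K] X) (c l : K) (h : ∀ u, T (g u) - c • g (S u) ∈ L) (a : ℕ) (u : W) :
    ((T - (c * l) • (1 : End K X)) ^ a) (g u) - c ^ a • g (((S - l • (1 : End K W)) ^ a) u) ∈ L := by
  have hinv : ∀ a, ∀ x ∈ L, ((T - (c * l) • (1 : End K X)) ^ a) x ∈ L := by
    intro a
    induction a with
    | zero => simp
    | succ a ih =>
      intro x hx
      rw [pow_succ, Module.End.mul_apply]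
      exact ih _ (L.sub_mem (hT x hx) (L.smul_mem _ hx))
  induction a generalizing u with
  | zero => simp
  | succ a ih =>
    set u' := (S - l • (1 : End K W)) u with hu'
    have h1 : (T - (c * l) • (1 : End K X)) (g u) = c • g u' + (T (g u) - c • g (S u)) := by
      simp only [hu', LinearMap.sub_apply, LinearMap.smul_apply, Module.End.one_apply, map_sub,
        map_smul, smul_sub, smul_smul]
      abel
    rw [pow_succ' c, pow_succ, pow_succ, Module.End.mul_apply, Module.End.mul_apply, ← hu', h1,
      map_add, map_smul, add_sub_right_comm, mul_smul c (c ^ a), ← smul_sub]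
    exact L.add_mem (L.smul_mem _ (ih u')) (hinv a _ (h u))

/-! ### Existence of the solution -/

/-- The dual of `E`, with the transpose of `φ'(0) ^ (d + 1)`, embeds into the analytic functions of
order `d + 1` at `0`, with the operator `C_φ`, up to an error of arbitrarily high order. -/
theorem exists_dual_intertwining_mod {E : Type*} [NormedAddCommGroup E] [NormedSpace ℂ E]
    [FiniteDimensional ℂ E] {φ : E → E} (hφ : AnalyticOnNhd ℂ φ (ball 0 1))
    (hmaps : Set.MapsTo φ (ball 0 1) (ball 0 1)) (hφ0 : φ 0 = 0)
    (hsurj : Function.Surjective (fderiv ℂ φ 0)) (d N : ℕ) (hN : d + 2 ≤ N) :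
    ∃ f : Module.Dual ℂ E →ₗ[ℂ] (E → ℂ), (∀ w, AnalyticOnNhd ℂ (f w) (ball 0 1)) ∧
      (∀ w, (fun z => f w (φ z) - f (w ∘ₗ ((fderiv ℂ φ 0 : E →ₗ[ℂ] E) ^ (d + 1))) z) ∈
        vanishingSubmodule E N) ∧
      ∀ w, f w ∈ vanishingSubmodule E N → w = 0 := by
  set A : E →ₗ[ℂ] E := (fderiv ℂ φ 0 : E →ₗ[ℂ] E) with hA
  set S : Module.End ℂ (Module.Dual ℂ E) := A.dualMap with hS
  obtain ⟨r, l, m, w, hw, hwi, hdim⟩ := exists_jordanChains S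
  set e : Fin r → Module.Dual ℂ E := fun i =>
    ((S - l i • (1 : Module.End ℂ (Module.Dual ℂ E))) ^ m i) (w i) with he
  have hSe : ∀ i, S (e i) = l i • e i := by
    intro i
    have := hw i
    rw [pow_succ', Module.End.mul_apply, LinearMap.sub_apply, sub_eq_zero] at this
    simpa using this
  -- For `l i = 0` the functional `e i` would vanish on the range of `φ'(0)`, which is everything.
  have hl : ∀ i, l i ≠ 0 := by
    intro i hli
    refine hwi.ne_zero i ?_
    ext v
    obtain ⟨v, rfl⟩ := hsurj v
    have := LinearMap.congr_fun (hSe i) v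
    rw [hli, zero_smul] at this
    exact this
  have hcomp : ∀ D, ∀ f ∈ vanishingSubmodule E D,
      LinearMap.funLeft ℂ ℂ φ f ∈ vanishingSubmodule E D := fun D f hf =>
    comp_mem_vanishingSubmodule hφ hmaps hφ0 hf
  let T : Module.End ℂ (vanishingSubmodule E (d + 1)) :=
    (LinearMap.funLeft ℂ ℂ φ).restrict (hcomp (d + 1))
  have hT : ∀ D, ∀ x ∈ (vanishingSubmodule E D).submoduleOf (vanishingSubmodule E (d + 1)),
      T x ∈ (vanishingSubmodule E D).submoduleOf (vanishingSubmodule E (d + 1)) :=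
    fun D x hx => hcomp D _ hx
  have := finiteDimensional_quotient_vanishingSubmodule (E := E) (d + 1) N
  have hchain : ∀ i a, ((T - (l i ^ (d + 1)) • (1 : Module.End ℂ (vanishingSubmodule E (d + 1)))) ^ a)
      (dualMonomial d (e i) (w i)) - (l i ^ d) ^ a • dualMonomial d (e i)
        (((S - l i • (1 : Module.End ℂ (Module.Dual ℂ E))) ^ a) (w i)) ∈
      (vanishingSubmodule E (d + 2)).submoduleOf (vanishingSubmodule E (d + 1)) := by
    intro i a
    rw [pow_succ (l i) d]
    refine sub_smul_one_pow_apply_sub_mem T _ (hT _) S (dualMonomial d (e i)) (l i ^ d) (l i)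
      (fun u => ?_) a (w i)
    exact comp_dualMonomial_sub_mem hφ hmaps hφ0 d (fun v => LinearMap.congr_fun (hSe i) v) u
  have hpow := fun i => pow_sub_smul_one_pow_apply S (l i) (m i) (d + 1) (w i) (hw i)
  have hwi' : LinearIndependent ℂ fun i =>
      ((S ^ (d + 1) - l i ^ (d + 1) • (1 : Module.End ℂ (Module.Dual ℂ E))) ^ m i) (w i) := by
    have hc : ∀ i, (((d + 1 : ℕ) : ℂ) * l i ^ (d + 1 - 1)) ^ m i ≠ 0 := fun i =>
      pow_ne_zero _ (mul_ne_zero (Nat.cast_ne_zero.mpr d.succ_ne_zero) (pow_ne_zero _ (hl i)))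
    have := hwi.units_smul fun i => Units.mk0 _ (hc i)
    rw [show (fun i => ((S ^ (d + 1) - l i ^ (d + 1) • (1 : Module.End ℂ (Module.Dual ℂ E))) ^ m i)
      (w i)) = _ from funext fun i => (hpow i).2]
    exact this
  obtain ⟨f, hf1, hf2⟩ := exists_linearMap_intertwining_mod T
    ((vanishingSubmodule E (d + 2)).submoduleOf (vanishingSubmodule E (d + 1)))
    ((vanishingSubmodule E N).submoduleOf (vanishingSubmodule E (d + 1)))
    (fun x hx => vanishingSubmodule_anti hN hx) (hT _) (hT _) (S ^ (d + 1))
    (fun i => l i ^ (d + 1)) m w (fun i => dualMonomial d (e i) (w i)) (fun i => (hpow i).1) hwi'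
    hdim (fun i => by
      have := hchain i (m i + 1)
      rwa [hw, map_zero, smul_zero, sub_zero] at this) (by
      rw [Fintype.linearIndependent_iff]
      intro c hc i
      -- Modulo order `d + 2` the monomial chain ends in a nonzero multiple of `e i ^ (d + 1)`.
      have h1 : ∀ i, Submodule.mkQ _ (((T - (l i ^ (d + 1)) • (1 : Module.End ℂ (vanishingSubmodule E (d + 1)))) ^ m i)
          (dualMonomial d (e i) (w i))) = Submodule.mkQ ((vanishingSubmodule E (d + 2)).submoduleOf
            (vanishingSubmodule E (d + 1))) ((l i ^ d) ^ m i • dualMonomial d (e i) (e i)) := by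
        intro i
        exact (Submodule.Quotient.eq _).mpr (hchain i (m i))
      have hc' : Submodule.mkQ ((vanishingSubmodule E (d + 2)).submoduleOf
          (vanishingSubmodule E (d + 1)))
            (∑ i, c i • (l i ^ d) ^ m i • dualMonomial d (e i) (e i)) = 0 := by
        rw [← hc, map_sum]
        refine Finset.sum_congr rfl fun i _ => ?_
        rw [map_smul, h1 i]
      rw [Submodule.mkQ_apply, Submodule.Quotient.mk_eq_zero] at hc'
      have h2 := eq_zero_of_sum_pow_mem_vanishingSubmodule hwi (d + 1) d.succ_ne_zero
        (fun i => c i * (l i ^ d) ^ m i) (by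
          have h3 : ((vanishingSubmodule E (d + 1)).subtype
            (∑ i, c i • (l i ^ d) ^ m i • dualMonomial d (e i) (e i))) ∈
              vanishingSubmodule E (d + 2) := hc'
          convert h3 using 1
          funext z
          rw [map_sum, Finset.sum_apply]
          refine Finset.sum_congr rfl fun i _ => ?_
          simp [dualMonomial, pow_succ, mul_assoc, he]) i
      exact (mul_eq_zero.mp h2).resolve_right (pow_ne_zero _ (pow_ne_zero _ (hl i))))
  refine ⟨(vanishingSubmodule E (d + 1)).subtype ∘ₗ f, fun v => (f v).2.1, fun v => ?_,
    fun v hv => hf2 v hv⟩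
  have h1 := hf1 v
  have h2 : ∀ j (v : Module.Dual ℂ E), (S ^ j) v = v ∘ₗ (A ^ j) := by
    intro j
    induction j with
    | zero => intro v; rfl
    | succ j ih =>
      intro v
      rw [pow_succ', Module.End.mul_apply, ih, pow_succ]
      rfl
  rw [h2] at h1
  exact h1

open Module in
theorem exists_analytic_solution {E : Type*} [NormedAddCommGroup E] [NormedSpace ℂ E]
    [FiniteDimensional ℂ E] {φ : E → E} (hφ : AnalyticOnNhd ℂ φ (ball 0 1))
    (hmaps : Set.MapsTo φ (ball 0 1) (ball 0 1)) (hφ0 : φ 0 = 0)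
    (hlt : ∀ z ∈ ball (0 : E) 1, z ≠ 0 → ‖φ z‖ < ‖z‖) (hA : ‖fderiv ℂ φ 0‖ < 1)
    (hinj : Function.Injective (fderiv ℂ φ 0)) (k : ℕ) (hk : 1 ≤ k) :
    ∃ F : E → E, AnalyticOnNhd ℂ F (ball 0 1) ∧
      (∀ z ∈ ball (0 : E) 1, F (φ z) = ((fderiv ℂ φ 0) ^ k) (F z)) ∧
      ∀ w : Dual ℂ E, (∀ z ∈ ball (0 : E) 1, w (F z) = 0) → w = 0 := by
  obtain ⟨d, rfl⟩ : ∃ d, k = d + 1 := ⟨k - 1, by omega⟩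
  have hproper : ProperSpace E := FiniteDimensional.proper ℂ E
  have hcomplete : CompleteSpace E := FiniteDimensional.complete ℂ E
  set A := fderiv ℂ φ 0 with hAdef
  have hpow : ((A ^ (d + 1) : E →L[ℂ] E) : E →ₗ[ℂ] E) = (A : E →ₗ[ℂ] E) ^ (d + 1) :=
    ContinuousLinearMap.toLinearMap_pow _ _
  have hsurj : Function.Surjective A := LinearMap.injective_iff_surjective.mp hinj
  have hsurjk : Function.Surjective ((A ^ (d + 1) : E →L[ℂ] E) : E →ₗ[ℂ] E) := by
    rw [hpow, Module.End.coe_pow]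
    exact hsurj.iterate _
  set P' : E →L[ℂ] E := LinearMap.toContinuousLinearMap
    ((LinearEquiv.ofInjectiveEndo _ (LinearMap.injective_iff_surjective.mpr hsurjk)).symm :
      E →ₗ[ℂ] E) with hP'
  have hP : ∀ v, (A ^ (d + 1)) (P' v) = v := fun v =>
    LinearMap.congr_fun (LinearEquiv.ofInjectiveEndo_right_inv _
      (LinearMap.injective_iff_surjective.mpr hsurjk)) v
  obtain ⟨q, hq, hq1⟩ := exists_between hA
  have hq0 : 0 ≤ q := (norm_nonneg _).trans hq.le
  obtain ⟨N, hN, hdN⟩ : ∃ N : ℕ, ‖P'‖ * q ^ N < 1 ∧ d + 2 ≤ N := by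
    have h1 := (tendsto_pow_atTop_nhds_zero_of_lt_one hq0 hq1).const_mul ‖P'‖
    rw [mul_zero] at h1
    exact ((h1.eventually_lt_const one_pos).and (Filter.eventually_ge_atTop (d + 2))).exists
  obtain ⟨f, hfA, hf1, hf2⟩ := exists_dual_intertwining_mod hφ hmaps hφ0 hsurj d N hdN
  -- By reflexivity `F₀ z` is the vector on which each functional `w` takes the value `f w z`.
  let F₀ : E → E := fun z => (evalEquiv ℂ E).symm (LinearMap.proj z ∘ₗ f)
  have hF₀ : ∀ (w : Dual ℂ E) z, w (F₀ z) = f w z := by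
    intro w z
    rw [← Dual.eval_apply, ← evalEquiv_toLinearMap]
    exact LinearMap.congr_fun ((evalEquiv ℂ E).apply_symm_apply (LinearMap.proj z ∘ₗ f)) w
  let b := finBasis ℂ E
  have hF₀A : AnalyticOnNhd ℂ F₀ (ball 0 1) := by
    have h1 : F₀ = fun z => ∑ i, f (b.coord i) z • b i := by
      funext z
      rw [← b.sum_repr (F₀ z)]
      refine Finset.sum_congr rfl fun i _ => ?_
      rw [← hF₀]
      rfl
    rw [h1]
    exact Finset.analyticOnNhd_fun_sum _ fun i _ => (hfA _).smul analyticOnNhd_const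
  have hR : (fun z => F₀ (φ z) - (A ^ (d + 1)) (F₀ z)) =O[𝓝 0] fun z => ‖z‖ ^ N := by
    have h1 : (fun z => F₀ (φ z) - (A ^ (d + 1)) (F₀ z)) = fun z => ∑ i,
        (f (b.coord i) (φ z) - f (b.coord i ∘ₗ ((A : E →ₗ[ℂ] E) ^ (d + 1))) z) • b i := by
      funext z
      rw [← b.sum_repr (F₀ (φ z) - (A ^ (d + 1)) (F₀ z))]
      refine Finset.sum_congr rfl fun i _ => ?_
      rw [← hF₀, ← hF₀, ← hpow, ← b.coord_apply, map_sub]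
      rfl
    rw [h1]
    refine Asymptotics.IsBigO.fun_sum fun i _ => ?_
    have h2 : ∀ g : E → ℂ, (fun z => g z • b i) =O[𝓝 0] g := fun g =>
      Asymptotics.IsBigO.of_bound ‖b i‖ (Filter.Eventually.of_forall fun z => by
        rw [norm_smul, mul_comm])
    exact (h2 _).trans (hf1 (b.coord i)).2
  obtain ⟨F, hFA, hFeq, hFO⟩ := exists_solution_of_approximate_solution hφ hφ0 hlt hq hq1
    (A ^ (d + 1)) P' hP hN hF₀A hR
  -- If `w ∘ F = 0` on the ball, then `f w = w ∘ F₀ = -w ∘ (F - F₀)` there, of order `N`, so `w =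
  -- 0`: independence survives the correction.
  refine ⟨F, hFA, hFeq, fun w hw => hf2 w ⟨hfA w, ?_⟩⟩
  have h1 := ((LinearMap.toContinuousLinearMap w).isBigO_comp _ (𝓝 0)).trans hFO
  refine (h1.neg_left).congr' ?_ Filter.EventuallyEq.rfl
  filter_upwards [ball_mem_nhds (0 : E) one_pos] with z hz
  simp [map_sub, hw z hz, hF₀]

/-! ### Determinants and the main theorem -/

theorem HasFullRankAt.det_ne_zero {n : ℕ} {F : Cn n → Cn n} {z : Cn n} (h : HasFullRankAt F z) :
    (fderiv ℂ F z).det ≠ 0 := by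
  have h1 : Module.finrank ℂ (LinearMap.range (fderiv ℂ F z : Cn n →ₗ[ℂ] Cn n)) = n := by
    have : Module.rank ℂ (LinearMap.range (fderiv ℂ F z : Cn n →ₗ[ℂ] Cn n)) = n := h
    rw [Module.finrank, this, Cardinal.toNat_natCast]
  have h2 : LinearMap.range (fderiv ℂ F z : Cn n →ₗ[ℂ] Cn n) = ⊤ :=
    Submodule.eq_top_of_finrank_eq (by rw [h1, finrank_euclideanSpace_fin])
  have h3 := LinearMap.injective_iff_surjective.mpr (LinearMap.range_eq_top.mp h2)
  rw [ContinuousLinearMap.det]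
  exact ((LinearMap.isUnit_iff_isUnit_det _).mp
    ((LinearMap.isUnit_iff_ker_eq_bot _).mpr (LinearMap.ker_eq_bot.mpr h3))).ne_zero

/-- The powers of `A` tend to `0`, hence so do those of `det A`; `n ≥ 1` ensures `det 0 = 0`. -/
theorem ContinuousLinearMap.norm_det_lt_one {n : ℕ} (hn : 1 ≤ n) (A : Cn n →L[ℂ] Cn n)
    (hA : ‖A‖ < 1) : ‖A.det‖ < 1 := by
  have h1 : Filter.Tendsto (fun j => (A ^ j).det) Filter.atTop (𝓝 0) := by
    have h2 := (ContinuousLinearMap.continuous_det (𝕜 := ℂ) (E := Cn n)).tendsto 0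
    have h3 : (0 : Cn n →L[ℂ] Cn n).det = 0 := by
      rw [ContinuousLinearMap.det, ContinuousLinearMap.toLinearMap_zero, LinearMap.det_zero,
        finrank_euclideanSpace_fin, zero_pow (by omega)]
    rw [h3] at h2
    exact h2.comp (tendsto_pow_atTop_nhds_zero_of_norm_lt_one hA)
  have h4 : ∀ j, (A ^ j).det = A.det ^ j := fun j => by
    rw [ContinuousLinearMap.det, ContinuousLinearMap.toLinearMap_pow, map_pow]
  simp_rw [h4] at h1
  simpa using tendsto_pow_atTop_nhds_zero_iff.mp (by simpa using h1.norm :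
    Filter.Tendsto (fun j => ‖A.det‖ ^ j) Filter.atTop (𝓝 0))

theorem mainTheorem4 (n : ℕ) (hn : 1 ≤ n) (φ : Cn n → Cn n)
    (hφ : IsAnalyticSelfMap φ) (hφ0 : φ 0 = 0) (hrank : HasFullRankAt φ 0)
    (hslice : ¬ IsUnitaryOnSomeSlice φ) (k : ℕ) (hk : 1 ≤ k) :
    (∃ F : Cn n → Cn n, IsIndependentSolution φ k F) ∧
    (1 < k → ∀ F : Cn n → Cn n, IsIndependentSolution φ k F →
      (fderiv ℂ F 0).det = 0 ∧ ¬ HasFullRankNearZero F) := by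
  have hA := hφ.norm_fderiv_lt_one hφ0 hslice
  have hdet := hrank.det_ne_zero
  refine ⟨?_, fun hk1 F hF => ?_⟩
  · have hinj : Function.Injective (fderiv ℂ φ 0) :=
      LinearMap.ker_eq_bot.mp ((LinearMap.isUnit_iff_ker_eq_bot _).mp
        ((LinearMap.isUnit_iff_isUnit_det _).mpr (isUnit_iff_ne_zero.mpr hdet)))
    obtain ⟨F, hFA, hFeq, hFi⟩ := exists_analytic_solution hφ.analytic hφ.mapsTo hφ0
      (fun z hz hz0 => hφ.norm_apply_lt hφ0 hslice hz hz0) hA hinj k hk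
    refine ⟨F, hFA, ?_, hFeq⟩
    rw [HasLinearlyIndependentComponents, Fintype.linearIndependent_iff]
    intro g hg i
    -- A linear relation among the components is a functional that annihilates `F`.
    let w : Module.Dual ℂ (Cn n) := ∑ j, g j • (EuclideanSpace.proj j : Cn n →L[ℂ] ℂ).toLinearMap
    have hw : ∀ v, w v = ∑ j, g j * v j := fun v => by simp [w]
    have hw0 : w = 0 := hFi w fun z hz => by
      have := congrFun hg ⟨z, hz⟩
      simpa [hw] using this
    have := hw (EuclideanSpace.single i 1)
    simpa [hw0] using this.symm
  · have h0 : (0 : Cn n) ∈ unitBall n := mem_ball_self one_pos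
    have hFd : DifferentiableAt ℂ F 0 := (hF.analytic 0 h0).differentiableAt
    have hφd : DifferentiableAt ℂ φ 0 := (hφ.analytic 0 h0).differentiableAt
    have heq : F ∘ φ =ᶠ[𝓝 0] fun z => ((fderiv ℂ φ 0) ^ k) (F z) := by
      filter_upwards [ball_mem_nhds (0 : Cn n) one_pos] with z hz
      exact hF.equation z hz
    have hchain : (fderiv ℂ F 0).comp (fderiv ℂ φ 0) =
        ((fderiv ℂ φ 0) ^ k).comp (fderiv ℂ F 0) := by
      have h1 := heq.fderiv_eq (𝕜 := ℂ)
      rw [fderiv_comp _ (by rwa [hφ0]) hφd, hφ0] at h1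
      exact h1.trans (HasFDerivAt.comp (0 : Cn n)
        (ContinuousLinearMap.hasFDerivAt ((fderiv ℂ φ 0) ^ k)) hFd.hasFDerivAt).fderiv
    have hF0 : (fderiv ℂ F 0).det = 0 := by
      by_contra hne
      have h1 := congrArg (fun L : Cn n →L[ℂ] Cn n => L.det) hchain
      simp only [ContinuousLinearMap.det, ContinuousLinearMap.toLinearMap_comp, LinearMap.det_comp,
        ContinuousLinearMap.toLinearMap_pow, map_pow] at h1
      change (fderiv ℂ F 0).det * (fderiv ℂ φ 0).det =
        (fderiv ℂ φ 0).det ^ k * (fderiv ℂ F 0).det at h1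
      rw [mul_comm] at h1
      have h2 := congrArg norm (mul_right_cancel₀ hne h1)
      have h3 := ContinuousLinearMap.norm_det_lt_one hn _ hA
      rw [norm_pow] at h2
      have h4 := pow_lt_pow_right_of_lt_one₀ (norm_pos_iff.mpr hdet) h3 hk1
      rw [pow_one] at h4
      exact h4.ne' h2
    exact ⟨hF0, fun h => h.self_of_nhds.det_ne_zero hF0⟩
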